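/- Let $d\ge 2$, let $B\subset\mathbb R^{d-1}$ be compact with non-empty interior, let $X=B\times[0,\infty)$, and let $Y\subset\mathbb R^d$ be compact and non-empty. Let $c:X\times Y\to[0,\infty)$ satisfy: (A) $c$ is locally Lipschitz; (B) for all $s\in B$, $y\in Y$ the function $t\mapsto c((s,t),y)$ is strictly increasing and unbounded on $[0,\infty)$; (C) the family $\{c((\cdot,t),y): t\in[0,\infty),\,y\in Y\}$ of functions on $B$ is equicontinuous. Let $\mathcal P_{\mathrm{ac}}(B)$ be the set of Borel probability measures on $B$ that are absolutely continuous with respect to Lebesgue measure, identified with their densities in $L^1(B)$. For $p\in\mathcal P_{\mathrm{ac}}(B)$ let $\mu_p$ be the Lebesgue measure restricted to $X_p=\{(s,t)\in X: t\le p(s)\}$, whose density is $\chi_{X_p}$. For $\nu\in\mathcal P(Y)$ put $$F_\nu(p)=\mathcal T_c(\mu_p,\nu)=\inf_{\gamma\in\Gamma(\mu_p,\nu)}\int_{X\times Y}c\,d\gamma\in[0,\infty],$$ where $\Gamma(\mu,\nu)$ is the set of Borel probability measures on $X\times Y$ with marginals $\mu$ and $\nu$; a minimiser in this infimum is called an optimal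 transport plan from $\mu_p$ to $\nu$. **Theorem 4.1.** 1. $F_\nu(p)$ is finite for $p\in \mathcal P_{\mathrm{ac}}(B)\cap L^\infty(B)$, and the map $(p,\nu)\mapsto F_\nu(p)\in\mathbb R$ is continuous on $\left(\mathcal P_{\mathrm{ac}}(B)\cap L^\infty(B),\|\cdot\|_{L^\infty(B)}\right)\times\mathcal P(Y)$, where $\mathcal P(Y)$ carries the weak topology. 2. For every $\nu\in\mathcal P(Y)$, $F_\nu$ has a unique minimiser over $\mathcal P_{\mathrm{ac}}(B)$. 3. Let $\nu_n\rightharpoonup\nu$ in $\mathcal P(Y)$, and let $p_n$ and $p$ be the minimisers over $\mathcal P_{\mathrm{ac}}(B)$ of $F_{\nu_n}$ and $F_\nu$. Then: - $F_{\nu_n}$ $\Gamma$-converges to $F_\nu$ on $\left(\mathcal P_{\mathrm{ac}}(B)\cap L^\infty(B),\|\cdot\|_{L^\infty(B)}\right)$; - $p_n$ and $p$ have continuous representatives on $B$, which can be chosen so that $p_n\to p$ uniformly on $B$; - $\mu_{p_n}\to\mu_p$ strongly in $L^1(X)$, i.e. $\|\chi_{X_{p_n}}-\chi_{X_p}\|_{L^1(X)}\to0$;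 - if $\gamma_n$ is an optimal transport plan from $\mu_{p_n}$ to $\nu_n$ for each $n$, then there are an optimal transport plan $\gamma$ from $\mu_p$ to $\nu$ and a subsequence $(\gamma_{n_k})$ with $\gamma_{n_k}\rightharpoonup\gamma$ weakly in $\mathcal P(X\times Y)$. -/

import Mathlib

open MeasureTheory Filter Topology
open scoped NNReal ENNReal

noncomputable section

/-! Kantorovich optimal transport -/

/-- Admissible transport plans: Borel probability measures on the product with marginals
`μ` and `ν`. -/
def transportPlans {α β : Type*} [MeasurableSpace α] [MeasurableSpace β]
    (μ : Measure α) (ν : Measure β) : Set (ProbabilityMeasure (α × β)) :=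
  {γ | (γ : Measure (α × β)).map Prod.fst = μ ∧ (γ : Measure (α × β)).map Prod.snd = ν}

/-- The cost of a plan, as an element of `[0, ∞]`. -/
def planCost {α β : Type*} [MeasurableSpace α] [MeasurableSpace β]
    (c : α × β → ℝ≥0) (γ : ProbabilityMeasure (α × β)) : ℝ≥0∞ :=
  ∫⁻ z, (c z : ℝ≥0∞) ∂(γ : Measure (α × β))

/-- The optimal transport cost from `μ` to `ν`, as an element of `[0, ∞]`. -/
def transportCost {α β : Type*} [MeasurableSpace α] [MeasurableSpace β]
    (c : α × β → ℝ≥0) (μ : Measure α) (ν : Measure β) : ℝ≥0∞ :=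
  ⨅ γ ∈ transportPlans μ ν, planCost c γ

/-- `γ` is an optimal transport plan from `μ` to `ν`. -/
def IsOptimalPlan {α β : Type*} [MeasurableSpace α] [MeasurableSpace β]
    (c : α × β → ℝ≥0) (μ : Measure α) (ν : Measure β)
    (γ : ProbabilityMeasure (α × β)) : Prop :=
  γ ∈ transportPlans μ ν ∧ planCost c γ = transportCost c μ ν

/-- Γ-convergence of a sequence of `[0, ∞]`-valued functionals on a metric space: the liminf
inequality along every convergent sequence, and existence of recovery sequences. -/
def GammaConverges {α : Type*} [MetricSpace α] (F : ℕ → α → ℝ≥0∞) (G : α → ℝ≥0∞) : Prop :=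
  ∀ x : α,
    (∀ u : ℕ → α, Tendsto u atTop (𝓝 x) → G x ≤ liminf (fun n => F n (u n)) atTop) ∧
    ∃ u : ℕ → α, Tendsto u atTop (𝓝 x) ∧ limsup (fun n => F n (u n)) atTop ≤ G x

/-! The free surface problem.  The source domain `B × [0, ∞)` is the type `B × ℝ≥0`. -/

/-- Lebesgue measure on `B`. -/
def lebesgueB {E : Type*} [MeasureSpace E] (B : Set E) : Measure B :=
  (volume : Measure E).comap Subtype.val

/-- Lebesgue measure on the source domain `B × [0, ∞)`. -/
def lebesgueX {E : Type*} [MeasureSpace E] (B : Set E) : Measure (B × ℝ≥0) :=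
  (lebesgueB B).prod ((volume : Measure ℝ).comap NNReal.toReal)

/-- The absolutely continuous probability measures on `B`, through their densities in `L¹(B)`. -/
abbrev Pac {E : Type*} [MeasureSpace E] (B : Set E) : Type _ :=
  {p : Lp ℝ 1 (lebesgueB B) // 0 ≤ p ∧ ∫ s, p s ∂lebesgueB B = 1}

/-- The absolutely continuous probability measures on `B` with density in `L^∞(B)`, with the
metric given by the `L^∞` norm. -/
abbrev PacBdd {E : Type*} [MeasureSpace E] (B : Set E) : Type _ :=
  {p : Lp ℝ ∞ (lebesgueB B) // 0 ≤ p ∧ ∫ s, p s ∂lebesgueB B = 1}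

/-- The region below the graph of `p` in `B × [0, ∞)`. -/
def subgraph {E : Type*} {B : Set E} (p : B → ℝ) : Set (B × ℝ≥0) :=
  {x | (x.2 : ℝ) ≤ p x.1}

/-- The source measure `μ_p`: Lebesgue measure restricted to the region below the graph of `p`.
It depends on `p` only through its almost everywhere class. -/
def sourceMeasure {E : Type*} [MeasureSpace E] {B : Set E} (p : B → ℝ) : Measure (B × ℝ≥0) :=
  (lebesgueX B).restrict (subgraph p)

/-- The Lebesgue density of `μ_p`. -/
def sourceDensity {E : Type*} {B : Set E} (p : B → ℝ) : B × ℝ≥0 → ℝ :=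
  (subgraph p).indicator 1

/-- The primal functional `F_ν(p) = T_c(μ_p, ν)`. -/
def primal {E E' : Type*} [MeasureSpace E] [MeasurableSpace E'] {B : Set E} {Y : Set E'}
    (c : (B × ℝ≥0) × Y → ℝ≥0) (ν : ProbabilityMeasure Y) (p : B → ℝ) : ℝ≥0∞ :=
  transportCost c (sourceMeasure p) (ν : Measure Y)

/-- `p` minimises `F_ν` over all absolutely continuous probability measures on `B`. -/
def IsMinimiser {E E' : Type*} [MeasureSpace E] [MeasurableSpace E'] {B : Set E} {Y : Set E'}
    (c : (B × ℝ≥0) × Y → ℝ≥0) (ν : ProbabilityMeasure Y) (p : Pac B) : Prop :=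
  ∀ q : Pac B, primal c ν p.1 ≤ primal c ν q.1

/-- The standing assumptions on the cost function. -/
structure CostAssumption {E E' : Type*} [PseudoEMetricSpace E] [PseudoEMetricSpace E']
    {B : Set E} {Y : Set E'} (c : (B × ℝ≥0) × Y → ℝ≥0) : Prop where
  locallyLipschitz : LocallyLipschitz c
  strictMono : ∀ (s : B) (y : Y), StrictMono fun t : ℝ≥0 => c ((s, t), y)
  unbounded : ∀ (s : B) (y : Y), ¬ BddAbove (Set.range fun t : ℝ≥0 => c ((s, t), y))
  equicontinuous : Equicontinuous fun (i : ℝ≥0 × Y) (s : B) => c ((s, i.1), i.2)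

end

/-! The constraint that the first marginal be a hypograph is relaxed: the cost is minimised over
plans with second marginal `ν` whose first marginal is only dominated by Lebesgue measure on the
cylinder (`relaxedPlans`). This set is convex and weakly closed, and since the cost tends to
infinity with the height, cost sublevels are compact; so a minimiser exists.

Moving mass of an optimal relaxed plan into unused room cannot pay: `c z ≤ c (x, z.2)` for `z` in
the support of the plan and `x` in the support of the unused part (`le_of_mem_support`). On a single
vertical fibre, strict monotonicity then puts used points below unused ones, so the first marginal
is a hypograph measure (`exists_hypograph`) and the relaxation is exact. For uniqueness, the average
of two optimal plans is optimal, so half the sum of two hypograph indicators is again an indicator,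
which forces them to agree.

The same inequality compares different points of the free surface `g`. Comparison with a point where
`g` is at most its mean bounds `g`; compactness and strict monotonicity give a modulus of
continuity. Both are independent of `ν` (`exists_uniform_regularity`).

For stability, optimal relaxed plans subconverge to optimal ones, and uniqueness makes the full
sequence of first marginals converge weakly. Outer regularity upgrades this to `L¹` convergence of
the indicators, and the common modulus upgrades that to uniform convergence of the densities.

Continuity of the cost on bounded densities rests on completing partial plans, at a price of at most
a constant times the missing mass (`transportCost_le_add`). Γ-convergence is a consequence of joint
continuity. -/

set_option linter.unusedSectionVars false

noncomputable section

/-! ### Lebesgue measure on the half-line and on a half-cylinder -/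

/-- Lebesgue measure on `[0, ∞)`. -/
def halfLine : Measure ℝ≥0 := (volume : Measure ℝ).comap NNReal.toReal

theorem measurableEmbedding_toReal : MeasurableEmbedding NNReal.toReal :=
  MeasurableEmbedding.subtype_coe measurableSet_Ici

theorem halfLine_apply (s : Set ℝ≥0) : halfLine s = volume (NNReal.toReal '' s) :=
  measurableEmbedding_toReal.comap_apply _ _

theorem halfLine_setOf_le (r : ℝ) : halfLine {t | (t : ℝ) ≤ r} = ENNReal.ofReal r := by
  have : NNReal.toReal '' {t | (t : ℝ) ≤ r} = Set.Icc 0 r := by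
    ext x
    constructor
    · rintro ⟨t, ht, rfl⟩
      exact ⟨t.2, ht⟩
    · rintro ⟨h0, hr⟩
      exact ⟨⟨x, h0⟩, hr, rfl⟩
  rw [halfLine_apply, this, Real.volume_Icc, sub_zero]

theorem halfLine_Iic (a : ℝ≥0) : halfLine (Set.Iic a) = a := by
  have := halfLine_setOf_le a
  simpa [Set.Iic] using this

instance : NullSingletonClass halfLine := ⟨fun x => by simp [halfLine_apply]⟩

instance : IsLocallyFiniteMeasure halfLine := ⟨fun x => ⟨Set.Iic (x + 1),
  Iic_mem_nhds (lt_add_of_pos_right _ one_pos), by simp [halfLine_Iic]⟩⟩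

theorem measurableSet_setOf_coe_le (r : ℝ) : MeasurableSet {t : ℝ≥0 | (t : ℝ) ≤ r} :=
  measurableSet_le measurable_coe_nnreal_real measurable_const

/-- Truncated subtraction covers both orders of `q` and `r` and negative values at once. -/
theorem halfLine_setOf_le_diff (r q : ℝ) :
    halfLine ({t | (t : ℝ) ≤ r} \ {t | (t : ℝ) ≤ q}) = ENNReal.ofReal r - ENNReal.ofReal q := by
  rcases le_total q r with h | h
  · have hsub : {t : ℝ≥0 | (t : ℝ) ≤ q} ⊆ {t : ℝ≥0 | (t : ℝ) ≤ r} := fun t ht => le_trans ht h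
    rw [measure_sdiff hsub (measurableSet_setOf_coe_le q).nullMeasurableSet
      (by simp [halfLine_setOf_le]), halfLine_setOf_le, halfLine_setOf_le]
  · rw [tsub_eq_zero_of_le (ENNReal.ofReal_le_ofReal h), Set.sdiff_eq_empty.2 fun t ht => ?_,
      measure_empty]
    exact le_trans (show (t : ℝ) ≤ r from ht) h

variable {S : Type*} [MeasurableSpace S]

/-- The product of a measure on `S` with Lebesgue measure on `[0, ∞)`. -/
def cylinderMeasure (β : Measure S) : Measure (S × ℝ≥0) := β.prod halfLine

/-- The region of `S × [0, ∞)` below the graph of `p`. -/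
def hypograph {S : Type*} (p : S → ℝ) : Set (S × ℝ≥0) := {x | (x.2 : ℝ) ≤ p x.1}

/-- The cylinder measure restricted to the region below the graph of `p`. -/
def hypographMeasure (β : Measure S) (p : S → ℝ) : Measure (S × ℝ≥0) :=
  (cylinderMeasure β).restrict (hypograph p)

theorem measurableSet_hypograph {p : S → ℝ} (hp : Measurable p) : MeasurableSet (hypograph p) :=
  measurableSet_le (measurable_coe_nnreal_real.comp measurable_snd) (hp.comp measurable_fst)

section

variable (β : Measure S)

theorem cylinderMeasure_hypograph {p : S → ℝ} (hp : Measurable p) :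
    cylinderMeasure β (hypograph p) = ∫⁻ s, ENNReal.ofReal (p s) ∂β := by
  rw [cylinderMeasure, Measure.prod_apply (measurableSet_hypograph hp)]
  exact lintegral_congr fun s => halfLine_setOf_le (p s)

theorem cylinderMeasure_hypograph_diff {p q : S → ℝ} (hp : Measurable p) (hq : Measurable q) :
    cylinderMeasure β (hypograph p \ hypograph q)
      = ∫⁻ s, (ENNReal.ofReal (p s) - ENNReal.ofReal (q s)) ∂β := by
  rw [cylinderMeasure,
    Measure.prod_apply ((measurableSet_hypograph hp).diff (measurableSet_hypograph hq))]
  exact lintegral_congr fun s => halfLine_setOf_le_diff (p s) (q s)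

theorem hypographMeasure_univ {p : S → ℝ} (hp : Measurable p) :
    hypographMeasure β p Set.univ = ∫⁻ s, ENNReal.ofReal (p s) ∂β := by
  rw [hypographMeasure, Measure.restrict_apply_univ, cylinderMeasure_hypograph β hp]

/-- Points of the cylinder almost surely have almost sure base points. -/
theorem ae_cylinderMeasure_fst {P : S → Prop} (h : ∀ᵐ s ∂β, P s) :
    ∀ᵐ x ∂cylinderMeasure β, P x.1 :=
  Measure.quasiMeasurePreserving_fst.ae h

theorem hypographMeasure_congr {p q : S → ℝ} (h : p =ᵐ[β] q) :
    hypographMeasure β p = hypographMeasure β q := by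
  refine Measure.restrict_congr_set ?_
  filter_upwards [ae_cylinderMeasure_fst β h] with x hx
  change ((x.2 : ℝ) ≤ p x.1) = ((x.2 : ℝ) ≤ q x.1)
  rw [hx]

theorem hypographMeasure_ae_le {p : S → ℝ} (hp : Measurable p) {R : ℝ} (hR : ∀ᵐ s ∂β, p s ≤ R) :
    ∀ᵐ x ∂hypographMeasure β p, (x.2 : ℝ) ≤ R := by
  rw [hypographMeasure, ae_restrict_iff' (measurableSet_hypograph hp)]
  filter_upwards [ae_cylinderMeasure_fst β hR] with x hx h
  exact le_trans h hx

/-- The graph of a measurable function is null. -/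
theorem cylinderMeasure_graph {g : S → ℝ≥0∞} (hg : Measurable g) :
    cylinderMeasure β {x | (x.2 : ℝ≥0∞) = g x.1} = 0 := by
  have hm : MeasurableSet {x : S × ℝ≥0 | (x.2 : ℝ≥0∞) = g x.1} := measurableSet_eq_fun
    (measurable_coe_nnreal_ennreal.comp measurable_snd) (hg.comp measurable_fst)
  rw [cylinderMeasure, Measure.measure_prod_null hm]
  refine Eventually.of_forall fun s => Set.Subsingleton.measure_zero ?_ _
  intro a ha b hb
  exact ENNReal.coe_injective ((show (a : ℝ≥0∞) = g s from ha).trans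
    (show (b : ℝ≥0∞) = g s from hb).symm)

end

/-- A density is determined almost everywhere by the measure below its graph. -/
theorem ae_eq_of_hypographMeasure_eq (β : Measure S) [IsFiniteMeasure β] {p q : S → ℝ}
    (hp : Measurable p) (hq : Measurable q) (hp0 : 0 ≤ᵐ[β] p) (hq0 : 0 ≤ᵐ[β] q)
    (h : hypographMeasure β p = hypographMeasure β q) : p =ᵐ[β] q := by
  -- Only the larger function needs a sign, since a hypograph sees a function through its positive
  -- part.
  have key : ∀ {p q : S → ℝ}, Measurable p → Measurable q → 0 ≤ᵐ[β] q →
      hypographMeasure β p = hypographMeasure β q → p ≤ᵐ[β] q := by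
    intro p q hp hq hq0 h
    have h1 : cylinderMeasure β (hypograph p \ hypograph q) = 0 := by
      have h2 := congrArg (fun m => m (hypograph q)ᶜ) h
      simp only [hypographMeasure] at h2
      rw [Measure.restrict_apply (measurableSet_hypograph hq).compl,
        Measure.restrict_apply (measurableSet_hypograph hq).compl] at h2
      simpa [Set.sdiff_eq, Set.inter_comm] using h2
    rw [cylinderMeasure_hypograph_diff β hp hq, lintegral_eq_zero_iff
      (by fun_prop)] at h1
    filter_upwards [h1, hq0] with s hs h0
    have := tsub_eq_zero_iff_le.1 hs
    exact (ENNReal.ofReal_le_ofReal_iff h0).1 this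
  exact (key hp hq hq0 h).antisymm (key hq hp hp0 h.symm)

/-! ### Comparison of transport costs -/

section Completion

variable {α Y : Type*} [MeasurableSpace α] [MeasurableSpace Y]

/-- A measure whose marginals are dominated by `μ` and `ν` can be completed to a transport plan. -/
theorem exists_plan_eq_add (μ : Measure α) (ν : Measure Y) [IsProbabilityMeasure μ]
    [IsProbabilityMeasure ν] (σ : Measure (α × Y)) (hμ : σ.map Prod.fst ≤ μ)
    (hν : σ.map Prod.snd ≤ ν) :
    ∃ γ ∈ transportPlans μ ν, ∃ τ : Measure (α × Y),
      (γ : Measure (α × Y)) = σ + τ ∧ τ Set.univ = 1 - σ Set.univ ∧ τ.map Prod.fst ≤ μ := by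
  have hu1 : σ.map Prod.fst Set.univ = σ Set.univ := by
    rw [Measure.map_apply measurable_fst MeasurableSet.univ, Set.preimage_univ]
  have hu2 : σ.map Prod.snd Set.univ = σ Set.univ := by
    rw [Measure.map_apply measurable_snd MeasurableSet.univ, Set.preimage_univ]
  have : IsFiniteMeasure (σ.map Prod.fst) := isFiniteMeasure_of_le μ hμ
  have : IsFiniteMeasure (σ.map Prod.snd) := isFiniteMeasure_of_le ν hν
  set a := μ - σ.map Prod.fst with ha
  set b := ν - σ.map Prod.snd with hb
  set m := 1 - σ Set.univ with hm
  have ham : a Set.univ = m := by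
    rw [ha, Measure.sub_apply MeasurableSet.univ hμ, hu1, measure_univ]
  have hbm : b Set.univ = m := by
    rw [hb, Measure.sub_apply MeasurableSet.univ hν, hu2, measure_univ]
  have hmt : m ≠ ∞ := ne_top_of_le_ne_top ENNReal.one_ne_top tsub_le_self
  have hσ1 : σ Set.univ ≤ 1 := by
    rw [← hu1]; exact (hμ _).trans_eq measure_univ
  -- The leftovers `a` and `b` have equal mass `m`, so the normalised product has them as marginals;
  -- if `m = 0` both vanish.
  set τ := m⁻¹ • a.prod b with hτ
  have hτ1 : τ.map Prod.fst = a := by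
    rw [hτ, Measure.map_smul, Measure.map_fst_prod, hbm, smul_smul]
    by_cases h0 : m = 0
    · have : a = 0 := Measure.measure_univ_eq_zero.1 (ham.trans h0)
      rw [this, smul_zero]
    · rw [ENNReal.inv_mul_cancel h0 hmt, one_smul]
  have hτ2 : τ.map Prod.snd = b := by
    rw [hτ, Measure.map_smul, Measure.map_snd_prod, ham, smul_smul]
    by_cases h0 : m = 0
    · have : b = 0 := Measure.measure_univ_eq_zero.1 (hbm.trans h0)
      rw [this, smul_zero]
    · rw [ENNReal.inv_mul_cancel h0 hmt, one_smul]
  have hτu : τ Set.univ = m := by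
    rw [← ham, ← hτ1, Measure.map_apply measurable_fst MeasurableSet.univ, Set.preimage_univ]
  have hprob : IsProbabilityMeasure (σ + τ) := ⟨by
    rw [Measure.add_apply, hτu, hm, add_tsub_cancel_of_le hσ1]⟩
  refine ⟨⟨σ + τ, hprob⟩, ⟨?_, ?_⟩, τ, rfl, hτu, ?_⟩
  · change (σ + τ).map Prod.fst = μ
    rw [Measure.map_add _ _ measurable_fst, hτ1, add_comm, Measure.sub_add_cancel_of_le hμ]
  · change (σ + τ).map Prod.snd = ν
    rw [Measure.map_add _ _ measurable_snd, hτ2, add_comm, Measure.sub_add_cancel_of_le hν]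
  · rw [hτ1]
    exact Measure.sub_le

theorem map_sum_measure {f : α → Y} (hf : Measurable f) {ι : Type*} [Fintype ι]
    (m : ι → Measure α) : (∑ i, m i).map f = ∑ i, (m i).map f := by
  ext s hs
  rw [Measure.map_apply hf hs, Measure.finsetSum_apply, Measure.finsetSum_apply]
  exact Finset.sum_congr rfl fun i _ => (Measure.map_apply hf hs).symm

variable (c : α × Y → ℝ≥0)

/-- A partial plan gives an upper bound for the transport cost. -/
theorem transportCost_le_add {μ : Measure α} {ν : Measure Y} [IsProbabilityMeasure μ]
    [IsProbabilityMeasure ν] (σ : Measure (α × Y)) (hμ : σ.map Prod.fst ≤ μ)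
    (hν : σ.map Prod.snd ≤ ν) {C : ℝ≥0} (hC : ∀ᵐ x ∂μ, ∀ y, c (x, y) ≤ C) :
    transportCost c μ ν ≤ ∫⁻ z, c z ∂σ + C * (1 - σ Set.univ) := by
  obtain ⟨γ, hγ, τ, hτ, hu, hτμ⟩ := exists_plan_eq_add μ ν σ hμ hν
  refine (iInf₂_le γ hγ).trans ?_
  rw [planCost, hτ, lintegral_add_measure, ← hu, ← lintegral_const]
  refine add_le_add le_rfl (lintegral_mono_ae ?_)
  have h1 : ∀ᵐ x ∂τ.map Prod.fst, ∀ y, c (x, y) ≤ C := hC.filter_mono (ae_mono hτμ)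
  filter_upwards [ae_of_ae_map measurable_fst.aemeasurable h1] with z hz
  exact ENNReal.coe_le_coe.2 (hz z.2)

theorem transportCost_le_const {μ : Measure α} {ν : Measure Y} [IsProbabilityMeasure μ]
    [IsProbabilityMeasure ν] {C : ℝ≥0} (hC : ∀ᵐ x ∂μ, ∀ y, c (x, y) ≤ C) :
    transportCost c μ ν ≤ C := by
  simpa using transportCost_le_add c (μ := μ) (ν := ν) 0 (by simp; exact Measure.zero_le _)
    (by simp; exact Measure.zero_le _) hC

/-- Dependence of the transport cost on the first marginal. -/
theorem transportCost_le_of_restrict_le {μ μ' : Measure α} {ν : Measure Y}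
    [IsProbabilityMeasure μ'] [IsProbabilityMeasure ν]
    {A : Set α} (hA : MeasurableSet A) (h : μ.restrict A ≤ μ')
    {C : ℝ≥0} (hC : ∀ᵐ x ∂μ', ∀ y, c (x, y) ≤ C) :
    transportCost c μ' ν ≤ transportCost c μ ν + C * μ Aᶜ := by
  conv_rhs => rw [transportCost, ENNReal.iInf_add]
  refine le_iInf fun γ => ?_
  rw [ENNReal.iInf_add]
  refine le_iInf fun hγ => ?_
  -- The part of `γ` over `A` is a partial plan to `μ'`; the mass it misses is `μ Aᶜ`.
  set σ := (γ : Measure (α × Y)).restrict (Prod.fst ⁻¹' A) with hσ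
  have hA' : MeasurableSet (Prod.fst ⁻¹' A : Set (α × Y)) := measurable_fst hA
  have h1 : σ.map Prod.fst ≤ μ' := by
    rw [hσ, ← Measure.restrict_map measurable_fst hA, hγ.1]; exact h
  have h2 : σ.map Prod.snd ≤ ν :=
    (Measure.map_mono Measure.restrict_le_self measurable_snd).trans_eq hγ.2
  refine (transportCost_le_add c σ h1 h2 hC).trans ?_
  gcongr ?_ + _ * ?_
  · exact lintegral_mono' Measure.restrict_le_self le_rfl
  · rw [hσ, Measure.restrict_apply_univ, ← prob_compl_eq_one_sub hA', ← hγ.1,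
      Measure.map_apply measurable_fst hA.compl]
    rfl

/-- Dependence of the transport cost on the second marginal, through a partition of unity of
functions on whose supports the cost varies by at most `ε`. -/
theorem transportCost_le_of_partition (hc : Measurable c) {μ : Measure α} {ν ν' : Measure Y}
    [IsProbabilityMeasure μ] [IsProbabilityMeasure ν] [IsProbabilityMeasure ν']
    {ι : Type*} [Fintype ι] (k : ι → Y → ℝ≥0∞) (hk : ∀ i, Measurable (k i))
    (hsum : ∀ y, ∑ i, k i y = 1) {C ε : ℝ≥0} (hC : ∀ᵐ x ∂μ, ∀ y, c (x, y) ≤ C)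
    (hε : ∀ᵐ x ∂μ, ∀ i y y', k i y ≠ 0 → k i y' ≠ 0 → c (x, y') ≤ c (x, y) + ε) :
    transportCost c μ ν' ≤ transportCost c μ ν + ε
      + C * ∑ i, (∫⁻ y, k i y ∂ν - ∫⁻ y, k i y ∂ν') := by
  have hk1 : ∀ i y, k i y ≤ 1 := fun i y => by
    rw [← hsum y]
    exact Finset.single_le_sum (f := fun i => k i y) (fun _ _ => zero_le) (Finset.mem_univ i)
  rw [add_assoc]
  conv_rhs => rw [transportCost, ENNReal.iInf_add]
  refine le_iInf fun γ => ?_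
  rw [ENNReal.iInf_add]
  refine le_iInf fun hγ => ?_
  set a : ι → ℝ≥0∞ := fun i => ∫⁻ y, k i y ∂ν with ha
  set b : ι → ℝ≥0∞ := fun i => ∫⁻ y, k i y ∂ν' with hb
  have hat : ∀ i, a i ≠ ∞ := fun i => ne_top_of_le_ne_top ENNReal.one_ne_top
    ((lintegral_mono (hk1 i)).trans_eq (by simp))
  have hbt : ∀ i, b i ≠ ∞ := fun i => ne_top_of_le_ne_top ENNReal.one_ne_top
    ((lintegral_mono (hk1 i)).trans_eq (by simp))
  have hasum : ∑ i, a i = 1 := by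
    rw [ha, ← lintegral_finsetSum _ fun i _ => hk i]; simp [hsum]
  -- This normalisation makes `w i * (a i * b i)` the minimum of `a i` and `b i`, the mass that can
  -- stay within cell `i`.
  set w : ι → ℝ≥0∞ := fun i => (max (a i) (b i))⁻¹ with hw
  have hwa : ∀ i, w i * a i ≤ 1 := fun i =>
    (mul_le_mul_right (le_max_left (a i) (b i)) _).trans (ENNReal.inv_mul_le_one _)
  have hwb : ∀ i, w i * b i ≤ 1 := fun i =>
    (mul_le_mul_right (le_max_right (a i) (b i)) _).trans (ENNReal.inv_mul_le_one _)
  have hwab : ∀ i, a i ≤ w i * (a i * b i) + (a i - b i) := by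
    intro i
    rcases le_total (a i) (b i) with h | h
    · by_cases h0 : b i = 0
      · have : a i = 0 := le_antisymm (h.trans_eq h0) zero_le
        simp [this]
      · simp only [hw, max_eq_right h]
        rw [mul_comm (a i), ← mul_assoc, ENNReal.inv_mul_cancel h0 (hbt i), one_mul]
        exact le_self_add
    · by_cases h0 : a i = 0
      · simp [h0]
      · simp only [hw, max_eq_left h]
        rw [← mul_assoc, ENNReal.inv_mul_cancel h0 (hat i), one_mul, add_tsub_cancel_of_le h]
  set G : ι → Measure (α × Y) := fun i => (γ : Measure (α × Y)).withDensity fun z => k i z.2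
    with hG
  set N : ι → Measure Y := fun i => ν'.withDensity (k i) with hN
  have hk2 : ∀ i, Measurable fun z : α × Y => k i z.2 := fun i => (hk i).comp measurable_snd
  have hGu : ∀ i, G i Set.univ = a i := fun i => by
    rw [hG]
    simp only
    rw [withDensity_apply _ MeasurableSet.univ, Measure.restrict_univ, ha, ← hγ.2]
    simp only
    rw [lintegral_map (hk i) measurable_snd]
  have hNu : ∀ i, N i Set.univ = b i := fun i => by
    simp only [hN]
    rw [withDensity_apply _ MeasurableSet.univ, Measure.restrict_univ]
  have hGf : ∀ i, IsFiniteMeasure (G i) := fun i => ⟨by rw [hGu]; exact (hat i).lt_top⟩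
  have hNf : ∀ i, IsFiniteMeasure (N i) := fun i => ⟨by rw [hNu]; exact (hbt i).lt_top⟩
  have hGsum : ∑ i, G i = γ := by
    ext s hs
    rw [Measure.finsetSum_apply]
    simp only [hG, withDensity_apply _ hs]
    rw [← lintegral_finsetSum _ fun i _ => hk2 i]
    simp [hsum]
  have hNsum : ∑ i, N i = ν' := by
    ext s hs
    rw [Measure.finsetSum_apply]
    simp only [hN, withDensity_apply _ hs]
    rw [← lintegral_finsetSum _ fun i _ => hk i]
    simp [hsum]
  -- Within each cell the target point is redrawn independently from `ν'`, which raises the cost by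
  -- at most `ε`.
  set σ : Measure (α × Y) := ∑ i, w i • ((G i).map Prod.fst).prod (N i) with hσ
  have hmapu : ∀ i, (G i).map Prod.fst Set.univ = a i := fun i => by
    rw [Measure.map_apply measurable_fst MeasurableSet.univ, Set.preimage_univ, hGu]
  have h1 : σ.map Prod.fst ≤ μ := by
    rw [hσ, map_sum_measure measurable_fst, ← hγ.1, ← hGsum, map_sum_measure measurable_fst]
    refine Finset.sum_le_sum fun i _ => ?_
    rw [Measure.map_smul, Measure.map_fst_prod, hNu, smul_smul]
    refine Measure.le_iff.2 fun s _ => ?_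
    rw [Measure.smul_apply, smul_eq_mul]
    exact mul_le_of_le_one_left zero_le (hwb i)
  have h2 : σ.map Prod.snd ≤ ν' := by
    rw [hσ, map_sum_measure measurable_snd, ← hNsum]
    refine Finset.sum_le_sum fun i _ => ?_
    rw [Measure.map_smul, Measure.map_snd_prod, hmapu, smul_smul]
    refine Measure.le_iff.2 fun s _ => ?_
    rw [Measure.smul_apply, smul_eq_mul]
    exact mul_le_of_le_one_left zero_le (hwa i)
  refine (transportCost_le_add c σ h1 h2 hC).trans ?_
  rw [← add_assoc]
  gcongr ?_ + _ * ?_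
  · have hcost : ∀ i, ∫⁻ z, c z ∂(w i • ((G i).map Prod.fst).prod (N i))
        ≤ ∫⁻ z, (c z + ε : ℝ≥0∞) ∂G i := by
      intro i
      have hcm : Measurable fun z => (c z : ℝ≥0∞) := hc.coe_nnreal_ennreal
      rw [lintegral_smul_measure, lintegral_prod _ hcm.aemeasurable,
        lintegral_map hcm.lintegral_prod_right' measurable_fst, smul_eq_mul]
      have hstep : ∫⁻ z, ∫⁻ y, (c (z.1, y) : ℝ≥0∞) ∂N i ∂G i
          ≤ ∫⁻ z, (c z + ε : ℝ≥0∞) * b i ∂G i := by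
        refine lintegral_mono_ae ?_
        rw [hG, ae_withDensity_iff (hk2 i)]
        rw [← hγ.1] at hε
        filter_upwards [ae_of_ae_map measurable_fst.aemeasurable hε] with z hz h0
        rw [← hNu i, ← lintegral_const]
        refine lintegral_mono_ae ?_
        rw [hN, ae_withDensity_iff (hk i)]
        refine Eventually.of_forall fun y hy => ?_
        exact_mod_cast hz i z.2 y h0 hy
      calc w i * ∫⁻ z, ∫⁻ y, (c (z.1, y) : ℝ≥0∞) ∂N i ∂G i
          ≤ w i * ∫⁻ z, (c z + ε : ℝ≥0∞) * b i ∂G i := by gcongr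
        _ = (w i * b i) * ∫⁻ z, (c z + ε : ℝ≥0∞) ∂G i := by
            rw [lintegral_mul_const _ (hcm.add_const _)]; ring
        _ ≤ _ := mul_le_of_le_one_left zero_le (hwb i)
    calc ∫⁻ z, c z ∂σ = ∑ i, ∫⁻ z, c z ∂(w i • ((G i).map Prod.fst).prod (N i)) := by
          rw [hσ, lintegral_finsetSum_measure]
      _ ≤ ∑ i, ∫⁻ z, (c z + ε : ℝ≥0∞) ∂G i := Finset.sum_le_sum fun i _ => hcost i
      _ = ∫⁻ z, (c z + ε : ℝ≥0∞) ∂(γ : Measure (α × Y)) := by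
          rw [← lintegral_finsetSum_measure, hGsum]
      _ = planCost c γ + ε := by
          rw [lintegral_add_right _ measurable_const]; simp [planCost]
  · rw [tsub_le_iff_right, ← hasum, hσ, Measure.finsetSum_apply, ← Finset.sum_add_distrib]
    refine Finset.sum_le_sum fun i _ => ?_
    rw [Measure.smul_apply, smul_eq_mul, ← Set.univ_prod_univ, Measure.prod_prod, hmapu, hNu,
      add_comm]
    exact hwab i

end Completion

/-! ### Continuity of the transport cost on bounded densities -/

section Continuity

variable {S : Type*} [MetricSpace S] [CompactSpace S]
  {Y : Type*} [MetricSpace Y] [CompactSpace Y] {c : (S × ℝ≥0) × Y → ℝ≥0}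

theorem isCompact_slab (R : ℝ≥0) : IsCompact {z : (S × ℝ≥0) × Y | z.1.2 ≤ R} := by
  have : {z : (S × ℝ≥0) × Y | z.1.2 ≤ R} = (Set.univ ×ˢ Set.Icc 0 R) ×ˢ Set.univ := by
    ext; simp
  rw [this]
  exact (isCompact_univ.prod isCompact_Icc).prod isCompact_univ

theorem exists_cost_le (hc : Continuous c) (R : ℝ≥0) :
    ∃ C : ℝ≥0, ∀ s t y, t ≤ R → c ((s, t), y) ≤ C := by
  obtain ⟨C, hC⟩ := ((isCompact_slab (S := S) (Y := Y) R).image hc).bddAbove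
  exact ⟨C, fun s t y ht => hC ⟨((s, t), y), ht, rfl⟩⟩

theorem exists_cost_le_add (hc : Continuous c) (R : ℝ≥0) {ε : ℝ≥0} (hε : 0 < ε) :
    ∃ δ > 0, ∀ s t y y', t ≤ R → dist y y' < δ → c ((s, t), y') ≤ c ((s, t), y) + ε := by
  have h := (isCompact_slab (S := S) (Y := Y) R).uniformContinuousOn_of_continuous hc.continuousOn
  obtain ⟨δ, hδ, h⟩ := Metric.uniformContinuousOn_iff.1 h ε (by exact_mod_cast hε)
  refine ⟨δ, hδ, fun s t y y' ht hy => ?_⟩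
  have h1 := h ((s, t), y') ht ((s, t), y) ht (by simpa [Prod.dist_eq, hδ, dist_comm] using hy)
  rw [NNReal.dist_eq] at h1
  have h2 := (abs_lt.1 h1).2
  rw [← NNReal.coe_le_coe, NNReal.coe_add]
  linarith

/-- A compact metric space has finite continuous partitions of unity of small mesh. -/
theorem exists_partition_of_unity {δ : ℝ} (hδ : 0 < δ) :
    ∃ (s : Finset Y) (k : s → Y → ℝ≥0), (∀ i, Continuous (k i)) ∧ (∀ y, ∑ i, k i y = 1) ∧
      ∀ i y y', k i y ≠ 0 → k i y' ≠ 0 → dist y y' < δ := by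
  obtain ⟨s, -, hs⟩ := (isCompact_univ (X := Y)).elim_nhds_subcover
    (fun y => Metric.ball y (δ / 2)) fun y _ => Metric.ball_mem_nhds y (half_pos hδ)
  obtain ⟨f, hf⟩ := PartitionOfUnity.exists_isSubordinate isClosed_univ
    (fun i : s => Metric.ball (i : Y) (δ / 2)) (fun _ => Metric.isOpen_ball)
    (fun y hy => by
      obtain ⟨i, hi, hy⟩ := Set.mem_iUnion₂.1 (hs hy)
      exact Set.mem_iUnion.2 ⟨⟨i, hi⟩, hy⟩)
  have hmem : ∀ (i : s) y, (f i y).toNNReal ≠ 0 → dist y i < δ / 2 := by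
    intro i y h
    have : f i y ≠ 0 := fun h0 => h (by simp [h0])
    exact hf i (subset_tsupport _ this)
  refine ⟨s, fun i y => (f i y).toNNReal, fun i => continuous_real_toNNReal.comp (f i).continuous, fun y => ?_,
    fun i y y' h h' => ?_⟩
  · rw [← Real.toNNReal_sum_of_nonneg fun i _ => f.nonneg i y,
      ← finsum_eq_sum_of_fintype, f.sum_eq_one (Set.mem_univ y), Real.toNNReal_one]
  · calc dist y y' ≤ dist y i + dist y' i := dist_triangle_right _ _ _
      _ < δ / 2 + δ / 2 := add_lt_add (hmem i y h) (hmem i y' h')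
      _ = δ := add_halves δ

variable [MeasurableSpace S] [BorelSpace S] [MeasurableSpace Y] [BorelSpace Y]

/-- Weak continuity of the transport cost in the second marginal. -/
theorem eventually_transportCost_le_add (hc : Continuous c) {μ : Measure (S × ℝ≥0)}
    [IsProbabilityMeasure μ] {R : ℝ≥0} (hR : ∀ᵐ x ∂μ, x.2 ≤ R) (ν₀ : ProbabilityMeasure Y)
    {ε : ℝ≥0} (hε : 0 < ε) :
    ∀ᶠ ν : ProbabilityMeasure Y in 𝓝 ν₀,
      transportCost c μ (ν : Measure Y) ≤ transportCost c μ (ν₀ : Measure Y) + ε ∧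
      transportCost c μ (ν₀ : Measure Y) ≤ transportCost c μ (ν : Measure Y) + ε := by
  obtain ⟨C, hC⟩ := exists_cost_le (Y := Y) hc R
  -- Half of `ε` pays for the oscillation of `c` over a cell, the other half for the change of the
  -- cell masses, which is weakly continuous.
  obtain ⟨δ, hδ, hcδ⟩ := exists_cost_le_add (Y := Y) hc R (half_pos hε)
  obtain ⟨s, k, hk, hsum, hkδ⟩ := exists_partition_of_unity (Y := Y) hδ
  have hC' : ∀ᵐ x ∂μ, ∀ y, c (x, y) ≤ C := hR.mono fun x hx y => hC x.1 x.2 y hx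
  have hε' : ∀ᵐ x ∂μ, ∀ i y y', (k i y : ℝ≥0∞) ≠ 0 → (k i y' : ℝ≥0∞) ≠ 0 →
      c (x, y') ≤ c (x, y) + ε / 2 := hR.mono fun x hx i y y' h h' =>
    hcδ x.1 x.2 y y' hx (hkδ i y y' (by simpa using h) (by simpa using h'))
  have hsum' : ∀ y, ∑ i, (k i y : ℝ≥0∞) = 1 := fun y => by exact_mod_cast hsum y
  have hkm : ∀ i, Measurable fun y => (k i y : ℝ≥0∞) := fun i =>
    (hk i).measurable.coe_nnreal_ennreal
  have hint : ∀ i, Continuous fun ν : ProbabilityMeasure Y => ∫⁻ y, k i y ∂(ν : Measure Y) := by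
    intro i
    refine continuous_iff_continuousAt.2 fun ν => ?_
    exact ProbabilityMeasure.tendsto_iff_forall_lintegral_tendsto.1 tendsto_id
      (BoundedContinuousFunction.mkOfCompact ⟨k i, hk i⟩)
  have hfin : ∀ i, ∫⁻ y, k i y ∂(ν₀ : Measure Y) ≠ ∞ := fun i => by
    refine ne_top_of_le_ne_top ENNReal.one_ne_top
      ((lintegral_mono fun y => ?_).trans_eq (by simp : ∫⁻ _, 1 ∂(ν₀ : Measure Y) = 1))
    rw [← hsum' y]
    exact Finset.single_le_sum (f := fun i => (k i y : ℝ≥0∞)) (fun _ _ => zero_le)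
      (Finset.mem_univ i)
  have hpos : (0 : ℝ≥0∞) < (ε / 2 : ℝ≥0) := by exact_mod_cast half_pos hε
  have hsplit : ∀ {a b d : ℝ≥0∞}, a ≤ b + (ε / 2 : ℝ≥0) + d → d < (ε / 2 : ℝ≥0) → a ≤ b + ε := by
    intro a b d h hd
    refine h.trans ?_
    calc b + (ε / 2 : ℝ≥0) + d ≤ b + (ε / 2 : ℝ≥0) + (ε / 2 : ℝ≥0) := by gcongr
      _ = b + ε := by rw [add_assoc, ← ENNReal.coe_add, add_halves]
  have ht1 : Tendsto (fun ν : ProbabilityMeasure Y =>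
      (C : ℝ≥0∞) * ∑ i, (∫⁻ y, k i y ∂(ν₀ : Measure Y) - ∫⁻ y, k i y ∂(ν : Measure Y)))
      (𝓝 ν₀) (𝓝 0) := by
    have : Tendsto (fun ν : ProbabilityMeasure Y =>
      (C : ℝ≥0∞) * ∑ i, (∫⁻ y, k i y ∂(ν₀ : Measure Y) - ∫⁻ y, k i y ∂(ν : Measure Y)))
      (𝓝 ν₀) (𝓝 ((C : ℝ≥0∞) *
        ∑ i, (∫⁻ y, k i y ∂(ν₀ : Measure Y) - ∫⁻ y, k i y ∂(ν₀ : Measure Y)))) :=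
      ENNReal.Tendsto.const_mul (tendsto_finsetSum _ fun i _ => ENNReal.Tendsto.sub
        tendsto_const_nhds ((hint i).tendsto ν₀) (Or.inl (hfin i))) (Or.inr ENNReal.coe_ne_top)
    simpa using this
  have ht2 : Tendsto (fun ν : ProbabilityMeasure Y =>
      (C : ℝ≥0∞) * ∑ i, (∫⁻ y, k i y ∂(ν : Measure Y) - ∫⁻ y, k i y ∂(ν₀ : Measure Y)))
      (𝓝 ν₀) (𝓝 0) := by
    have : Tendsto (fun ν : ProbabilityMeasure Y =>
      (C : ℝ≥0∞) * ∑ i, (∫⁻ y, k i y ∂(ν : Measure Y) - ∫⁻ y, k i y ∂(ν₀ : Measure Y)))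
      (𝓝 ν₀) (𝓝 ((C : ℝ≥0∞) *
        ∑ i, (∫⁻ y, k i y ∂(ν₀ : Measure Y) - ∫⁻ y, k i y ∂(ν₀ : Measure Y)))) :=
      ENNReal.Tendsto.const_mul (tendsto_finsetSum _ fun i _ => ENNReal.Tendsto.sub
        ((hint i).tendsto ν₀) tendsto_const_nhds (Or.inr (hfin i))) (Or.inr ENNReal.coe_ne_top)
    simpa using this
  filter_upwards [ht1.eventually_lt_const hpos, ht2.eventually_lt_const hpos] with ν h1 h2
  exact ⟨hsplit (transportCost_le_of_partition c hc.measurable _ hkm hsum' hC' hε') h1,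
    hsplit (transportCost_le_of_partition c hc.measurable _ hkm hsum' hC' hε') h2⟩

variable (β : Measure S) [IsFiniteMeasure β]

theorem isProbabilityMeasure_hypographMeasure {p : S → ℝ} (hp : Measurable p)
    (h1 : ∫⁻ s, ENNReal.ofReal (p s) ∂β = 1) : IsProbabilityMeasure (hypographMeasure β p) :=
  ⟨by rw [hypographMeasure_univ β hp, h1]⟩

theorem transportCost_ne_top (hc : Continuous c) {p : S → ℝ} (hp : Measurable p)
    (h1 : ∫⁻ s, ENNReal.ofReal (p s) ∂β = 1) {R : ℝ≥0} (hR : ∀ᵐ s ∂β, p s ≤ R)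
    (ν : ProbabilityMeasure Y) : transportCost c (hypographMeasure β p) (ν : Measure Y) ≠ ∞ := by
  have := isProbabilityMeasure_hypographMeasure β hp h1
  obtain ⟨C, hC⟩ := exists_cost_le (Y := Y) hc R
  refine ne_top_of_le_ne_top (ENNReal.coe_ne_top (r := C)) (transportCost_le_const c ?_)
  filter_upwards [hypographMeasure_ae_le β hp hR] with x hx y
  exact hC x.1 x.2 y hx

/-- The transport cost is Lipschitz in bounded densities, uniformly in the second marginal. -/
theorem transportCost_hypograph_le {p q : S → ℝ} (hp : Measurable p) (hq : Measurable q)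
    (hq1 : ∫⁻ s, ENNReal.ofReal (q s) ∂β = 1)
    {C : ℝ≥0} (hC : ∀ᵐ x ∂hypographMeasure β q, ∀ y : Y, c (x, y) ≤ C)
    {η : ℝ≥0} (hη : ∀ᵐ s ∂β, p s ≤ q s + η) (ν : ProbabilityMeasure Y) :
    transportCost c (hypographMeasure β q) (ν : Measure Y)
      ≤ transportCost c (hypographMeasure β p) (ν : Measure Y) + C * (η * β Set.univ) := by
  have := isProbabilityMeasure_hypographMeasure β hq hq1
  have hr : (hypographMeasure β p).restrict (hypograph q) ≤ hypographMeasure β q := by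
    rw [hypographMeasure, Measure.restrict_restrict (measurableSet_hypograph hq)]
    exact Measure.restrict_mono Set.inter_subset_left le_rfl
  refine (transportCost_le_of_restrict_le c (measurableSet_hypograph hq) hr hC).trans ?_
  gcongr
  rw [hypographMeasure, Measure.restrict_apply (measurableSet_hypograph hq).compl, Set.inter_comm,
    ← Set.sdiff_eq, cylinderMeasure_hypograph_diff β hp hq, ← lintegral_const]
  refine lintegral_mono_ae (hη.mono fun s hs => ?_)
  rw [tsub_le_iff_left]
  calc ENNReal.ofReal (p s) ≤ ENNReal.ofReal (q s + η) := ENNReal.ofReal_le_ofReal hs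
    _ ≤ ENNReal.ofReal (q s) + ENNReal.ofReal η := ENNReal.ofReal_add_le
    _ = _ := by rw [ENNReal.ofReal_coe_nnreal]

/-- Joint continuity of the transport cost in the density (uniformly) and the target (weakly). -/
theorem tendsto_transportCost_hypograph (hc : Continuous c) {ι : Type*} {l : Filter ι}
    {p : ι → S → ℝ} {p₀ : S → ℝ} (hp : ∀ i, Measurable (p i)) (hp₀ : Measurable p₀)
    (hp1 : ∀ i, ∫⁻ s, ENNReal.ofReal (p i s) ∂β = 1) (hp₀1 : ∫⁻ s, ENNReal.ofReal (p₀ s) ∂β = 1)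
    {R : ℝ≥0} (hR : ∀ᵐ s ∂β, p₀ s ≤ R)
    (hlim : ∀ η : ℝ≥0, 0 < η → ∀ᶠ i in l, ∀ᵐ s ∂β, |p i s - p₀ s| ≤ η)
    {ν : ι → ProbabilityMeasure Y} {ν₀ : ProbabilityMeasure Y} (hν : Tendsto ν l (𝓝 ν₀)) :
    Tendsto (fun i => transportCost c (hypographMeasure β (p i)) (ν i : Measure Y)) l
      (𝓝 (transportCost c (hypographMeasure β p₀) (ν₀ : Measure Y))) := by
  have := isProbabilityMeasure_hypographMeasure β hp₀ hp₀1
  have hT := transportCost_ne_top β hc hp₀ hp₀1 hR ν₀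
  -- Since `η ≤ 1` below, all densities within `η` of `p₀` stay under `R + 1`, and one constant
  -- serves them all.
  obtain ⟨C, hC⟩ := exists_cost_le (Y := Y) hc (R + 1)
  have hcost : ∀ {q : S → ℝ}, Measurable q → (∀ᵐ s ∂β, q s ≤ (R + 1 : ℝ≥0)) →
      ∀ᵐ x ∂hypographMeasure β q, ∀ y : Y, c (x, y) ≤ C := fun hq h => by
    filter_upwards [hypographMeasure_ae_le β hq h] with x hx y
    exact hC x.1 x.2 y hx
  rw [ENNReal.tendsto_nhds hT]
  intro ε hε
  obtain ⟨ε', hε'0, hε'⟩ : ∃ e : ℝ≥0, 0 < e ∧ (e : ℝ≥0∞) ≤ ε := by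
    rcases eq_or_ne ε ∞ with rfl | h
    · exact ⟨1, one_pos, le_top⟩
    · exact ⟨ε.toNNReal, ENNReal.toNNReal_pos hε.ne' h, (ENNReal.coe_toNNReal h).le⟩
  set b : ℝ≥0 := (β Set.univ).toNNReal with hb
  have hbβ : β Set.univ = b := (ENNReal.coe_toNNReal (measure_ne_top _ _)).symm
  set η : ℝ≥0 := min 1 (ε' / 2 / (C * b + 1)) with hη
  have hη0 : 0 < η := lt_min one_pos (by positivity)
  have hηle : (C : ℝ≥0∞) * (η * β Set.univ) ≤ (ε' / 2 : ℝ≥0) := by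
    rw [hbβ]
    norm_cast
    calc C * (η * b) = η * (C * b) := by ring
      _ ≤ ε' / 2 / (C * b + 1) * (C * b + 1) := by
        gcongr
        · exact min_le_right _ _
        · exact le_self_add
      _ = ε' / 2 := div_mul_cancel₀ _ (by positivity)
  have hR0 : ∀ᵐ x ∂hypographMeasure β p₀, x.2 ≤ R := hypographMeasure_ae_le β hp₀ hR
  filter_upwards [hlim η hη0,
    hν.eventually (eventually_transportCost_le_add hc hR0 ν₀ (half_pos hε'0))] with i h1 h2
  have hle1 : ∀ᵐ s ∂β, p₀ s ≤ p i s + η := h1.mono fun s hs => by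
    have := (abs_le.1 hs).1; linarith
  have hle2 : ∀ᵐ s ∂β, p i s ≤ p₀ s + η := h1.mono fun s hs => by
    have := (abs_le.1 hs).2; linarith
  have hη1 : (η : ℝ) ≤ 1 := by exact_mod_cast min_le_left _ _
  have hRi : ∀ᵐ s ∂β, p i s ≤ (R + 1 : ℝ≥0) := by
    filter_upwards [hle2, hR] with s h h'
    push_cast
    linarith
  have hR' : ∀ᵐ s ∂β, p₀ s ≤ (R + 1 : ℝ≥0) := hR.mono fun s hs => by push_cast; linarith
  have e1 := transportCost_hypograph_le β hp₀ (hp i) (hp1 i) (hcost (hp i) hRi) hle1 (ν i)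
  have e2 := transportCost_hypograph_le β (hp i) hp₀ hp₀1 (hcost hp₀ hR') hle2 (ν i)
  have hsum : ((ε' / 2 : ℝ≥0) : ℝ≥0∞) + (ε' / 2 : ℝ≥0) ≤ ε := by
    rw [← ENNReal.coe_add, add_halves]; exact hε'
  constructor
  · rw [tsub_le_iff_right]
    calc _ ≤ _ := h2.2
      _ ≤ _ := add_le_add (e2.trans (add_le_add le_rfl hηle)) le_rfl
      _ ≤ _ := by rw [add_assoc]; exact add_le_add le_rfl hsum
  · calc _ ≤ _ := e1
      _ ≤ _ := add_le_add h2.1 hηle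
      _ ≤ _ := by rw [add_assoc]; exact add_le_add le_rfl hsum

end Continuity

/-! ### Compactness of transport plans of bounded cost -/

/-- Continuous costs that are strictly increasing and unbounded in the height. -/
structure IsHeightCost {S Y : Type*} [TopologicalSpace S] [TopologicalSpace Y]
    (c : (S × ℝ≥0) × Y → ℝ≥0) : Prop where
  continuous : Continuous c
  strictMono : ∀ (s : S) (y : Y), StrictMono fun t : ℝ≥0 => c ((s, t), y)
  unbounded : ∀ (s : S) (y : Y), ¬ BddAbove (Set.range fun t : ℝ≥0 => c ((s, t), y))

/-- Weak limits preserve domination by an outer regular measure. -/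
theorem ProbabilityMeasure.le_of_tendsto_of_le {X : Type*} [TopologicalSpace X] [MeasurableSpace X]
    [OpensMeasurableSpace X] [HasOuterApproxClosed X] {Λ : Measure X} [Λ.OuterRegular]
    {μ : ℕ → ProbabilityMeasure X} {μ₀ : ProbabilityMeasure X} (h : Tendsto μ atTop (𝓝 μ₀))
    (hle : ∀ n, (μ n : Measure X) ≤ Λ) : (μ₀ : Measure X) ≤ Λ := by
  refine Measure.le_iff.2 fun A _ => ?_
  -- Outer regularity reduces the claim to open sets, where the portmanteau inequality has the right
  -- direction.
  rw [A.measure_eq_iInf_isOpen Λ]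
  refine le_iInf₂ fun U hAU => le_iInf fun hU => ?_
  calc (μ₀ : Measure X) A ≤ (μ₀ : Measure X) U := measure_mono hAU
    _ ≤ liminf (fun n => (μ n : Measure X) U) atTop :=
      ProbabilityMeasure.le_liminf_measure_open_of_tendsto h hU
    _ ≤ liminf (fun _ : ℕ => Λ U) atTop := liminf_le_liminf (Eventually.of_forall fun n => hle n U)
    _ = Λ U := liminf_const _

/-- The cost is the supremum of the integrals of the truncations `min c n`, which are weakly
continuous. -/
theorem lowerSemicontinuous_planCost {α Y : Type*} [TopologicalSpace α] [MeasurableSpace α]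
    [TopologicalSpace Y] [MeasurableSpace Y] [OpensMeasurableSpace (α × Y)]
    {c : α × Y → ℝ≥0} (hc : Continuous c) : LowerSemicontinuous (planCost c) := by
  have heq : planCost c = fun γ : ProbabilityMeasure (α × Y) => ⨆ n : ℕ,
      ∫⁻ z, (min (c z) n : ℝ≥0) ∂(γ : Measure (α × Y)) := by
    funext γ
    rw [planCost, ← lintegral_iSup (fun n => (hc.min continuous_const).measurable.coe_nnreal_ennreal)
      (fun n m hnm z => by dsimp only; gcongr)]
    refine lintegral_congr fun z => le_antisymm ?_ (iSup_le fun n => by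
      exact_mod_cast min_le_left _ _)
    obtain ⟨n, hn⟩ := exists_nat_ge (c z)
    exact le_iSup_of_le n (by rw [min_eq_left hn])
  rw [heq]
  refine lowerSemicontinuous_iSup fun n => Continuous.lowerSemicontinuous ?_
  refine continuous_iff_continuousAt.2 fun γ => ?_
  exact ProbabilityMeasure.tendsto_iff_forall_lintegral_tendsto.1 tendsto_id
    (BoundedContinuousFunction.mkOfBound ⟨fun z => min (c z) n, hc.min continuous_const⟩ n
      fun z w => by
        rw [NNReal.dist_eq]
        exact abs_sub_le_of_nonneg_of_le (NNReal.coe_nonneg _)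
          (by exact_mod_cast min_le_right _ _) (NNReal.coe_nonneg _)
          (by exact_mod_cast min_le_right _ _))

section

variable {S : Type*} [MetricSpace S] [CompactSpace S]
  {Y : Type*} [MetricSpace Y] [CompactSpace Y] {c : (S × ℝ≥0) × Y → ℝ≥0}

/-- A Dini argument: the open sets where the cost at height `t` exceeds `M` increase with `t` and
cover the compact `S × Y`. -/
theorem IsHeightCost.exists_forall_lt (hc : IsHeightCost c) (M : ℝ≥0) :
    ∃ R : ℝ≥0, ∀ s t y, R ≤ t → M < c ((s, t), y) := by
  obtain ⟨R, hR⟩ := (isCompact_univ (X := S × Y)).elim_directed_cover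
    (fun t : ℝ≥0 => {z : S × Y | M < c ((z.1, t), z.2)})
    (fun t => isOpen_lt continuous_const (hc.continuous.comp (by fun_prop)))
    (fun z _ => by
      obtain ⟨_, ⟨t, rfl⟩, ht⟩ := not_bddAbove_iff.1 (hc.unbounded z.1 z.2) M
      exact Set.mem_iUnion.2 ⟨t, ht⟩)
    (fun a b => ⟨max a b,
      fun z hz => lt_of_lt_of_le hz ((hc.strictMono z.1 z.2).monotone (le_max_left a b)),
      fun z hz => lt_of_lt_of_le hz ((hc.strictMono z.1 z.2).monotone (le_max_right a b))⟩)
  exact ⟨R, fun s t y ht => lt_of_lt_of_le (hR (Set.mem_univ (s, y)))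
    ((hc.strictMono s y).monotone ht)⟩

variable [MeasurableSpace S] [BorelSpace S] [MeasurableSpace Y] [BorelSpace Y]

/-- Markov's inequality bounds the mass above a height where the cost exceeds `n` by `M / n`; this
is tightness, and Prokhorov's theorem applies. -/
theorem IsHeightCost.isCompact_setOf_planCost_le (hc : IsHeightCost c) {M : ℝ≥0∞} (hM : M ≠ ∞) :
    IsCompact {γ : ProbabilityMeasure ((S × ℝ≥0) × Y) | planCost c γ ≤ M} := by
  have hcl : IsClosed {γ : ProbabilityMeasure ((S × ℝ≥0) × Y) | planCost c γ ≤ M} :=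
    (lowerSemicontinuous_planCost hc.continuous).isClosed_preimage M
  rw [← hcl.closure_eq]
  refine isCompact_closure_of_isTightMeasureSet ?_
  rw [isTightMeasureSet_iff_exists_isCompact_measure_compl_le]
  intro ε hε
  obtain ⟨n, hn⟩ := ENNReal.exists_nat_mul_gt hε.ne' hM
  obtain ⟨R, hR⟩ := hc.exists_forall_lt n
  refine ⟨_, isCompact_slab R, ?_⟩
  rintro _ ⟨γ, hγ, rfl⟩
  have hn0 : (n : ℝ≥0∞) ≠ 0 := by
    rintro h0
    simp [h0] at hn
  refine (ENNReal.mul_le_mul_iff_right hn0 (ENNReal.natCast_ne_top n)).1 ?_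
  calc (n : ℝ≥0∞) * (γ : Measure ((S × ℝ≥0) × Y)) {z | z.1.2 ≤ R}ᶜ
      ≤ n * (γ : Measure ((S × ℝ≥0) × Y)) {z | (n : ℝ≥0∞) ≤ c z} := by
        gcongr
        intro z hz
        have : R < z.1.2 := not_le.1 hz
        exact_mod_cast (hR z.1.1 z.1.2 z.2 this.le).le
    _ ≤ planCost c γ := mul_meas_ge_le_lintegral hc.continuous.measurable.coe_nnreal_ennreal _
    _ ≤ M := hγ
    _ ≤ n * ε := hn.le

/-- The cost attains its infimum on closed sets of plans. -/
theorem IsHeightCost.exists_forall_planCost_le (hc : IsHeightCost c)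
    {P : Set (ProbabilityMeasure ((S × ℝ≥0) × Y))} (hP : IsClosed P)
    {γ₀ : ProbabilityMeasure ((S × ℝ≥0) × Y)} (h₀ : γ₀ ∈ P) (hfin : planCost c γ₀ ≠ ∞) :
    ∃ γ ∈ P, ∀ γ' ∈ P, planCost c γ ≤ planCost c γ' := by
  obtain ⟨γ, hγ, hmin⟩ := LowerSemicontinuousOn.exists_isMinOn
    (s := {γ | planCost c γ ≤ planCost c γ₀} ∩ P) ⟨γ₀, le_refl (planCost c γ₀), h₀⟩
    ((hc.isCompact_setOf_planCost_le hfin).inter_right hP)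
    ((lowerSemicontinuous_planCost hc.continuous).lowerSemicontinuousOn _)
  refine ⟨γ, hγ.2, fun γ' hγ' => ?_⟩
  rcases le_total (planCost c γ') (planCost c γ₀) with h | h
  · exact hmin ⟨h, hγ'⟩
  · exact hγ.1.trans h

end

/-! ### Plans with a prescribed second marginal and a dominated first marginal -/

/-- Probability measures with second marginal `ν` and first marginal at most `Λ`. -/
def relaxedPlans {α Y : Type*} [MeasurableSpace α] [MeasurableSpace Y]
    (Λ : Measure α) (ν : Measure Y) : Set (ProbabilityMeasure (α × Y)) :=
  {γ | (γ : Measure (α × Y)).map Prod.fst ≤ Λ ∧ (γ : Measure (α × Y)).map Prod.snd = ν}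

/-- `γ` minimises the cost among relaxed plans, with finite cost. -/
structure IsRelaxedOptimal {α Y : Type*} [MeasurableSpace α] [MeasurableSpace Y]
    (c : α × Y → ℝ≥0) (Λ : Measure α) (ν : Measure Y) (γ : ProbabilityMeasure (α × Y)) : Prop where
  mem : γ ∈ relaxedPlans Λ ν
  le : ∀ γ' ∈ relaxedPlans Λ ν, planCost c γ ≤ planCost c γ'
  ne_top : planCost c γ ≠ ∞

section

variable {α Y : Type*} [TopologicalSpace α] [MeasurableSpace α] [BorelSpace α]
  [TopologicalSpace.PseudoMetrizableSpace α] [SecondCountableTopology α]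
  [TopologicalSpace Y] [MeasurableSpace Y] [BorelSpace Y]
  [TopologicalSpace.MetrizableSpace Y] [SecondCountableTopology Y]

theorem map_snd_eq_of_tendsto {γ : ℕ → ProbabilityMeasure (α × Y)}
    {γ₀ : ProbabilityMeasure (α × Y)} (h : Tendsto γ atTop (𝓝 γ₀))
    {ν : ℕ → ProbabilityMeasure Y} {ν₀ : ProbabilityMeasure Y} (hν : Tendsto ν atTop (𝓝 ν₀))
    (hγ : ∀ n, (γ n : Measure (α × Y)).map Prod.snd = ν n) :
    (γ₀ : Measure (α × Y)).map Prod.snd = ν₀ := by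
  have h1 := ProbabilityMeasure.tendsto_map_of_tendsto_of_continuous γ γ₀ h continuous_snd
  have h2 : ∀ n, (γ n).map continuous_snd.aemeasurable = ν n := fun n => Subtype.ext (hγ n)
  simp only [h2] at h1
  exact congrArg (fun m : ProbabilityMeasure Y => (m : Measure Y)) (tendsto_nhds_unique h1 hν)

/-- Domination survives weak limits, whereas a weak limit of hypograph measures need not be one;
hence the relaxation. -/
theorem mem_relaxedPlans_of_tendsto {Λ : Measure α} [Λ.OuterRegular]
    {γ : ℕ → ProbabilityMeasure (α × Y)} {γ₀ : ProbabilityMeasure (α × Y)}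
    (h : Tendsto γ atTop (𝓝 γ₀)) {ν : ℕ → ProbabilityMeasure Y} {ν₀ : ProbabilityMeasure Y}
    (hν : Tendsto ν atTop (𝓝 ν₀)) (hγ : ∀ n, γ n ∈ relaxedPlans Λ (ν n : Measure Y)) :
    γ₀ ∈ relaxedPlans Λ (ν₀ : Measure Y) :=
  ⟨ProbabilityMeasure.le_of_tendsto_of_le
      (ProbabilityMeasure.tendsto_map_of_tendsto_of_continuous γ γ₀ h continuous_fst)
      fun n => (hγ n).1,
    map_snd_eq_of_tendsto h hν fun n => (hγ n).2⟩

theorem isClosed_relaxedPlans (Λ : Measure α) [Λ.OuterRegular] (ν : ProbabilityMeasure Y) :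
    IsClosed (relaxedPlans Λ (ν : Measure Y)) :=
  IsSeqClosed.isClosed fun _ _ hγ h => mem_relaxedPlans_of_tendsto h tendsto_const_nhds hγ

end

/-! ### The exchange principle -/

/-- Moving mass of an optimal relaxed plan into the unused part of `Λ` does not lower the cost. -/
theorem IsRelaxedOptimal.prod_exchange_eq_zero {α Y : Type*} [MeasurableSpace α]
    [MeasurableSpace Y] {c : α × Y → ℝ≥0} (hc : Measurable c) {Λ : Measure α} {ν : Measure Y}
    [IsProbabilityMeasure ν] {γ : ProbabilityMeasure (α × Y)} (h : IsRelaxedOptimal c Λ ν γ)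
    (l : Measure α) [IsFiniteMeasure l] (hl : (γ : Measure (α × Y)).map Prod.fst + l ≤ Λ) :
    ((γ : Measure (α × Y)).prod l) {w | c (w.2, w.1.2) < c w.1} = 0 := by
  set N : Set ((α × Y) × α) := {w | c (w.2, w.1.2) < c w.1} with hN
  have hT : Measurable fun w : (α × Y) × α => (w.2, w.1.2) := by fun_prop
  have hNm : MeasurableSet N := measurableSet_lt (hc.comp hT) (hc.comp measurable_fst)
  -- `κ` lives on pairs of a used point and a spare one whose exchange is strictly profitable.
  -- Below, `A` is the mass taken from `γ` and `B` the same mass placed at the spare points with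
  -- unchanged targets; `ε` makes both admissible.
  set κ := ((γ : Measure (α × Y)).prod l).restrict N with hκ
  set ε : ℝ≥0∞ := (1 + l Set.univ)⁻¹ with hε
  have hε0 : ε ≠ 0 := by simp [hε]
  have hεt : ε ≠ ∞ := by simp [hε]
  have hεl : ε * l Set.univ ≤ 1 :=
    (mul_le_mul_right le_add_self _).trans (ENNReal.inv_mul_le_one _)
  have hε1 : ε ≤ 1 := ENNReal.inv_le_one.2 le_self_add
  set A : Measure (α × Y) := ε • κ.map Prod.fst with hA
  set B : Measure (α × Y) := ε • κ.map fun w => (w.2, w.1.2) with hB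
  have hκle : κ ≤ (γ : Measure (α × Y)).prod l := Measure.restrict_le_self
  have hAγ : A ≤ γ := by
    refine Measure.le_iff.2 fun s hs => ?_
    calc A s ≤ ε * (((γ : Measure (α × Y)).prod l).map Prod.fst) s := by
          rw [hA, Measure.smul_apply, smul_eq_mul]
          exact mul_le_mul_right (Measure.map_mono hκle measurable_fst s) _
      _ = ε * l Set.univ * (γ : Measure (α × Y)) s := by
          rw [Measure.map_fst_prod, Measure.smul_apply, smul_eq_mul, mul_assoc]
      _ ≤ _ := mul_le_of_le_one_left zero_le hεl
  have hAfin : IsFiniteMeasure A := isFiniteMeasure_of_le _ hAγ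
  have hB1 : B.map Prod.fst ≤ l := by
    have : B.map Prod.fst = ε • κ.map Prod.snd := by
      rw [hB, Measure.map_smul, Measure.map_map measurable_fst hT]; rfl
    rw [this]
    refine Measure.le_iff.2 fun s hs => ?_
    calc (ε • κ.map Prod.snd) s
        ≤ ε * (((γ : Measure (α × Y)).prod l).map Prod.snd) s := by
          rw [Measure.smul_apply, smul_eq_mul]
          exact mul_le_mul_right (Measure.map_mono hκle measurable_snd s) _
      _ = ε * l s := by simp
      _ ≤ l s := mul_le_of_le_one_left zero_le hε1
  have hAB : A.map Prod.snd = B.map Prod.snd := by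
    rw [hA, hB, Measure.map_smul, Measure.map_smul, Measure.map_map measurable_snd measurable_fst,
      Measure.map_map measurable_snd hT]
    rfl
  set γ' : Measure (α × Y) := γ - A + B with hγ'
  have hsub : (γ : Measure (α × Y)) - A + A = γ := Measure.sub_add_cancel_of_le hAγ
  have hsnd : γ'.map Prod.snd = ν := by
    rw [hγ', Measure.map_add _ _ measurable_snd, ← hAB, ← Measure.map_add _ _ measurable_snd, hsub,
      h.mem.2]
  have hprob : IsProbabilityMeasure γ' := ⟨by
    have := congrArg (fun m => m Set.univ) hsnd
    simpa [Measure.map_apply measurable_snd MeasurableSet.univ] using this⟩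
  have hmem : (⟨γ', hprob⟩ : ProbabilityMeasure (α × Y)) ∈ relaxedPlans Λ ν := by
    refine ⟨le_trans ?_ hl, hsnd⟩
    change γ'.map Prod.fst ≤ _
    rw [hγ', Measure.map_add _ _ measurable_fst]
    exact add_le_add (Measure.map_mono Measure.sub_le measurable_fst) hB1
  have hcm : Measurable fun z => (c z : ℝ≥0∞) := hc.coe_nnreal_ennreal
  have hle : planCost c γ ≤ ∫⁻ z, c z ∂γ' := h.le _ hmem
  have hcA : ∫⁻ z, c z ∂A = ε * ∫⁻ w, c w.1 ∂κ := by
    rw [hA, lintegral_smul_measure, lintegral_map hcm measurable_fst, smul_eq_mul]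
  have hcB : ∫⁻ z, c z ∂B = ε * ∫⁻ w, c (w.2, w.1.2) ∂κ := by
    rw [hB, lintegral_smul_measure, lintegral_map hcm hT, smul_eq_mul]
  have hAt : ∫⁻ z, c z ∂A ≠ ∞ := ne_top_of_le_ne_top h.ne_top (lintegral_mono' hAγ le_rfl)
  have hdec : planCost c γ = ∫⁻ z, c z ∂((γ : Measure (α × Y)) - A) + ∫⁻ z, c z ∂A := by
    rw [← lintegral_add_measure, hsub]; rfl
  have hrt : ∫⁻ z, c z ∂((γ : Measure (α × Y)) - A) ≠ ∞ :=
    ne_top_of_le_ne_top h.ne_top (by rw [hdec]; exact le_self_add)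
  rw [hγ', lintegral_add_measure, hdec, ENNReal.add_le_add_iff_left hrt, hcA, hcB,
    ENNReal.mul_le_mul_iff_right hε0 hεt] at hle
  by_contra hne
  have hκ0 : κ ≠ 0 := fun h0 => hne (by rwa [hκ, Measure.restrict_eq_zero] at h0)
  have hfin : ∫⁻ w, (c w.1 : ℝ≥0∞) ∂κ ≠ ∞ := fun htop => hAt (by
    rw [hcA, htop, ENNReal.mul_top hε0])
  have hae : ∀ᵐ w ∂κ, (c (w.2, w.1.2) : ℝ≥0∞) < c w.1 := by
    filter_upwards [ae_restrict_mem hNm] with w hw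
    exact_mod_cast hw
  have hlt : ∫⁻ w, c (w.2, w.1.2) ∂κ < ∫⁻ w, (c w.1 : ℝ≥0∞) ∂κ :=
    lintegral_strict_mono hκ0 (hcm.comp measurable_fst).aemeasurable
      (ne_top_of_le_ne_top hfin (lintegral_mono_ae (hae.mono fun _ h => h.le))) hae
  exact absurd hle (not_le.2 hlt)

section

variable {S : Type*} [MetricSpace S] [CompactSpace S] [MeasurableSpace S] [BorelSpace S]
  {Y : Type*} [MetricSpace Y] [CompactSpace Y] [MeasurableSpace Y] [BorelSpace Y]
  {c : (S × ℝ≥0) × Y → ℝ≥0} {β : Measure S} [IsFiniteMeasure β]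

instance : IsLocallyFiniteMeasure (cylinderMeasure β) := by
  unfold cylinderMeasure; infer_instance

instance : SigmaFinite (cylinderMeasure β) := by
  unfold cylinderMeasure; infer_instance

/-- By continuity a profitable exchange would persist on a product of neighbourhoods, which has
positive mass by the definition of support. -/
theorem IsRelaxedOptimal.le_of_mem_support (hc : Continuous c) {ν : Measure Y}
    [IsProbabilityMeasure ν] {γ : ProbabilityMeasure ((S × ℝ≥0) × Y)}
    (h : IsRelaxedOptimal c (cylinderMeasure β) ν γ) {z : (S × ℝ≥0) × Y}
    (hz : z ∈ (γ : Measure ((S × ℝ≥0) × Y)).support) {x : S × ℝ≥0}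
    (hx : x ∈ (cylinderMeasure β - (γ : Measure ((S × ℝ≥0) × Y)).map Prod.fst).support) :
    c z ≤ c (x, z.2) := by
  by_contra! hlt
  set r := cylinderMeasure β - (γ : Measure ((S × ℝ≥0) × Y)).map Prod.fst with hr
  have hopen : IsOpen {w : ((S × ℝ≥0) × Y) × (S × ℝ≥0) | c (w.2, w.1.2) < c w.1} :=
    isOpen_lt (by fun_prop) (by fun_prop)
  obtain ⟨U, V, hU, hV, hzU, hxV, hUV⟩ := isOpen_prod_iff.1 hopen z x hlt
  -- The unused part may be infinite, while the exchange lemma needs a finite measure.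
  obtain ⟨W, hW, hWfin⟩ := (cylinderMeasure β).finiteAt_nhds x
  have hrW : r (V ∩ W) < ∞ :=
    lt_of_le_of_lt ((Measure.sub_le _).trans (measure_mono Set.inter_subset_right)) hWfin
  have hpos : 0 < r (V ∩ W) := (Measure.mem_support_iff_forall x).1 hx _
    (inter_mem (hV.mem_nhds hxV) hW)
  have hposU : 0 < (γ : Measure ((S × ℝ≥0) × Y)) U :=
    (Measure.mem_support_iff_forall z).1 hz _ (hU.mem_nhds hzU)
  have : IsFiniteMeasure (r.restrict (V ∩ W)) := ⟨by rwa [Measure.restrict_apply_univ]⟩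
  have h0 := h.prod_exchange_eq_zero hc.measurable (r.restrict (V ∩ W)) (by
    calc _ ≤ (γ : Measure ((S × ℝ≥0) × Y)).map Prod.fst + r :=
          add_le_add le_rfl Measure.restrict_le_self
      _ = cylinderMeasure β := by rw [add_comm, hr, Measure.sub_add_cancel_of_le h.mem.1])
  have h1 : (γ : Measure ((S × ℝ≥0) × Y)) U * r.restrict (V ∩ W) V = 0 := by
    rw [← Measure.prod_prod]
    exact measure_mono_null hUV h0
  rw [Measure.restrict_apply hV.measurableSet, ← Set.inter_assoc, Set.inter_self] at h1
  exact (ENNReal.mul_pos hposU.ne' hpos.ne').ne' h1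

end

/-- Needed so that a property of almost every height holds on a dense set of heights. -/
instance : Measure.IsOpenPosMeasure halfLine := ⟨by
  intro U hU ⟨t, ht⟩
  obtain ⟨u, htu, hu⟩ := exists_Ico_subset_of_mem_nhds (hU.mem_nhds ht) ⟨t + 1, by simp⟩
  obtain ⟨m, htm, hmu⟩ := exists_between htu
  have hsub : ({x : ℝ≥0 | (x : ℝ) ≤ m} \ {x | (x : ℝ) ≤ t}) ⊆ U := fun x hx =>
    hu ⟨le_of_lt (by simpa using hx.2), lt_of_le_of_lt (by exact_mod_cast hx.1) hmu⟩
  refine (lt_of_lt_of_le ?_ (measure_mono hsub)).ne'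
  rw [halfLine_setOf_le_diff, tsub_pos_iff_lt]
  simpa using htm⟩

/-- Full fibres carry infinite mass, which forces the free surface to be finite almost everywhere.
-/
theorem halfLine_univ : halfLine Set.univ = ∞ := by
  refine ENNReal.eq_top_of_forall_nnreal_le fun r => ?_
  rw [← halfLine_Iic]
  exact measure_mono (Set.subset_univ _)

/-! ### The structure of optimal relaxed plans -/

section FibreInf

variable {S : Type*}

/-- The infimum of the fibres of a subset of `S × [0, ∞)`. -/
def fibreInf (L : Set (S × ℝ≥0)) (s : S) : ℝ≥0∞ := ⨅ (t : ℝ≥0) (_ : (s, t) ∈ L), (t : ℝ≥0∞)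

theorem fibreInf_le {L : Set (S × ℝ≥0)} {s : S} {t : ℝ≥0} (h : (s, t) ∈ L) :
    fibreInf L s ≤ t := iInf₂_le t h

variable [TopologicalSpace S] {L : Set (S × ℝ≥0)}

theorem mem_of_fibreInf_ne_top (hL : IsClosed L) {s : S} (h : fibreInf L s ≠ ∞) :
    (s, (fibreInf L s).toNNReal) ∈ L := by
  set T : Set ℝ≥0 := {t | (s, t) ∈ L} with hT
  have hTc : IsClosed T := hL.preimage (by fun_prop : Continuous fun t : ℝ≥0 => (s, t))
  have hne : T.Nonempty := by
    by_contra hemp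
    refine h (le_antisymm le_top (le_iInf₂ fun t ht => ?_))
    exact absurd ⟨t, ht⟩ hemp
  have hmem : sInf T ∈ T := hTc.csInf_mem hne (OrderBot.bddBelow T)
  have heq : fibreInf L s = (sInf T : ℝ≥0) := le_antisymm (fibreInf_le hmem)
    (le_iInf₂ fun t ht => by exact_mod_cast csInf_le (OrderBot.bddBelow T) ht)
  rw [heq, ENNReal.toNNReal_coe]
  exact hmem

/-- Sublevel sets at finite levels are projections of compact sets, hence closed. -/
theorem measurable_fibreInf [T2Space S] [CompactSpace S] [MeasurableSpace S] [BorelSpace S]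
    (hL : IsClosed L) : Measurable (fibreInf L) := by
  refine measurable_of_Iic fun a => ?_
  induction a with
  | top => simp
  | coe a =>
    have heq : fibreInf L ⁻¹' Set.Iic (a : ℝ≥0∞)
        = Prod.fst '' (L ∩ Set.univ ×ˢ Set.Icc (0 : ℝ≥0) a) := by
      ext s
      constructor
      · intro hs
        have hs' : fibreInf L s ≤ a := hs
        refine ⟨(s, (fibreInf L s).toNNReal), ⟨mem_of_fibreInf_ne_top hL
          (ne_top_of_le_ne_top ENNReal.coe_ne_top hs'), Set.mem_univ _, zero_le, ?_⟩, rfl⟩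
        exact (ENNReal.toNNReal_mono ENNReal.coe_ne_top hs').trans_eq (ENNReal.toNNReal_coe a)
      · rintro ⟨⟨s', t⟩, ⟨hm, -, -, ht⟩, rfl⟩
        exact (fibreInf_le hm).trans (ENNReal.coe_le_coe.2 ht)
    rw [heq]
    exact (((isCompact_univ.prod isCompact_Icc).inter_left hL).image
      continuous_fst).isClosed.measurableSet

end FibreInf

section

variable {S : Type*} [MetricSpace S] [CompactSpace S] [MeasurableSpace S] [BorelSpace S]
  {Y : Type*} [MetricSpace Y] [CompactSpace Y] [MeasurableSpace Y] [BorelSpace Y]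
  {c : (S × ℝ≥0) × Y → ℝ≥0} {β : Measure S} [IsFiniteMeasure β]

/-- The first marginal of an optimal relaxed plan is the Lebesgue measure below a graph, and no mass
can be moved with profit from one point of the graph to another. -/
theorem IsRelaxedOptimal.exists_hypograph (hc : IsHeightCost c) {ν : Measure Y}
    [IsProbabilityMeasure ν] {γ : ProbabilityMeasure ((S × ℝ≥0) × Y)}
    (h : IsRelaxedOptimal c (cylinderMeasure β) ν γ) :
    ∃ g : S → ℝ≥0, Measurable g ∧
      (γ : Measure ((S × ℝ≥0) × Y)).map Prod.fst = hypographMeasure β (fun s => g s) ∧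
      ∃ D : Set S, (∀ᵐ s ∂β, s ∈ D) ∧
        ∀ s ∈ D, ∀ s' ∈ D, 0 < g s → ∃ y, c ((s, g s), y) ≤ c ((s', g s'), y) := by
  set m := (γ : Measure ((S × ℝ≥0) × Y)).map Prod.fst with hm
  have hmprob : IsProbabilityMeasure m := Measure.isProbabilityMeasure_map measurable_fst.aemeasurable
  set r := cylinderMeasure β - m with hr
  have hrm : r + m = cylinderMeasure β := Measure.sub_add_cancel_of_le h.mem.1
  set L := r.support with hL
  have hLc : IsClosed L := Measure.isClosed_support
  have hL0 : r Lᶜ = 0 := Measure.measure_compl_support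
  set A : Set (S × ℝ≥0) := Prod.fst '' (γ : Measure ((S × ℝ≥0) × Y)).support with hA
  have hAc : IsClosed A := isClosedMap_fst_of_compactSpace _ Measure.isClosed_support
  have hA0 : m Aᶜ = 0 := by
    rw [hm, Measure.map_apply measurable_fst hAc.measurableSet.compl]
    refine measure_mono_null ?_
      (Measure.measure_compl_support (μ := (γ : Measure ((S × ℝ≥0) × Y))))
    intro z hz hz'
    exact hz ⟨z, hz', rfl⟩
  have hex : ∀ x ∈ A, ∀ x' ∈ L, ∃ y, c (x, y) ≤ c (x', y) := by
    rintro _ ⟨z, hz, rfl⟩ x' hx'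
    exact ⟨z.2, h.le_of_mem_support hc.continuous hz hx'⟩
  set G := fibreInf L with hG
  have hGm : Measurable G := measurable_fibreInf hLc
  -- The exchange inequality on one fibre: strict monotonicity keeps used points from lying above
  -- spare ones.
  have hAG : ∀ x ∈ A, (x.2 : ℝ≥0∞) ≤ G x.1 := by
    intro x hx
    refine le_iInf₂ fun t ht => ENNReal.coe_le_coe.2 ?_
    obtain ⟨y, hy⟩ := hex x hx _ ht
    exact (hc.strictMono x.1 y).le_iff_le.1 hy
  have hmH : m {x : S × ℝ≥0 | (x.2 : ℝ≥0∞) ≤ G x.1}ᶜ = 0 :=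
    measure_mono_null (fun x hx hxA => hx (hAG x hxA)) hA0
  have hrlt : r {x : S × ℝ≥0 | (x.2 : ℝ≥0∞) < G x.1} = 0 :=
    measure_mono_null (fun x hx hxL => not_lt.2 (fibreInf_le (s := x.1) (t := x.2) hxL) hx) hL0
  have hrH : r {x : S × ℝ≥0 | (x.2 : ℝ≥0∞) ≤ G x.1} = 0 := by
    have hsub : {x : S × ℝ≥0 | (x.2 : ℝ≥0∞) ≤ G x.1} ⊆
        {x | (x.2 : ℝ≥0∞) < G x.1} ∪ {x | (x.2 : ℝ≥0∞) = G x.1} := fun x hx =>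
      lt_or_eq_of_le (show (x.2 : ℝ≥0∞) ≤ G x.1 from hx)
    refine measure_mono_null hsub (measure_union_null hrlt ?_)
    exact le_antisymm ((Measure.sub_le _).trans (cylinderMeasure_graph β hGm).le) zero_le
  have hmG : m = (cylinderMeasure β).restrict {x : S × ℝ≥0 | (x.2 : ℝ≥0∞) ≤ G x.1} := by
    rw [← hrm, Measure.restrict_add, Measure.restrict_eq_zero.2 hrH, zero_add, eq_comm]
    exact Measure.restrict_eq_self_of_ae_mem (by rw [ae_iff]; exact hmH)
  have hGfin : ∀ᵐ s ∂β, G s ≠ ∞ := by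
    rw [ae_iff]
    simp only [not_not]
    by_contra hne
    have h1 : cylinderMeasure β ({s | G s = ∞} ×ˢ Set.univ) ≤ 1 := by
      calc _ ≤ cylinderMeasure β {x : S × ℝ≥0 | (x.2 : ℝ≥0∞) ≤ G x.1} :=
            measure_mono fun x hx => by
              have : G x.1 = ∞ := hx.1
              simp [this]
        _ = m Set.univ := by rw [hmG, Measure.restrict_apply_univ]
        _ = 1 := measure_univ
    rw [cylinderMeasure, Measure.prod_prod, halfLine_univ, ENNReal.mul_top hne] at h1
    exact absurd h1 (by simp)
  refine ⟨fun s => (G s).toNNReal, hGm.ennreal_toNNReal, ?_,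
    {s | G s ≠ ∞ ∧ (0 < (G s).toNNReal → (s, (G s).toNNReal) ∈ A)}, ?_, ?_⟩
  · rw [hmG, hypographMeasure]
    refine Measure.restrict_congr_set ?_
    filter_upwards [ae_cylinderMeasure_fst β hGfin] with x hx
    change ((x.2 : ℝ≥0∞) ≤ G x.1) = ((x.2 : ℝ) ≤ (G x.1).toNNReal)
    conv_lhs => rw [← ENNReal.coe_toNNReal hx]
    simp
  -- Almost every point strictly below the graph is used. On almost every fibre the used heights are
  -- thus dense below `G s`, and closedness of `A` adds the top point, provided that there is room
  -- below it.
  · have hΛ : cylinderMeasure β (Aᶜ ∩ {x | (x.2 : ℝ≥0∞) < G x.1}) = 0 := by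
      rw [← hrm, Measure.add_apply, measure_mono_null Set.inter_subset_right hrlt,
        measure_mono_null Set.inter_subset_left hA0, add_zero]
    have hae := Measure.ae_ae_of_ae_prod (μ := β) (ν := halfLine)
      (p := fun x => x ∉ Aᶜ ∩ {x : S × ℝ≥0 | (x.2 : ℝ≥0∞) < G x.1})
      (measure_eq_zero_iff_ae_notMem.1 hΛ)
    filter_upwards [hae, hGfin] with s hs hfin
    refine ⟨hfin, fun hpos => ?_⟩
    have hdense : Dense {t : ℝ≥0 | (s, t) ∉ Aᶜ ∩ {x : S × ℝ≥0 | (x.2 : ℝ≥0∞) < G x.1}} :=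
      Measure.dense_of_ae hs
    have hcl : (G s).toNNReal ∈ closure (Set.Iio (G s).toNNReal) := by
      rw [closure_Iio' (a := (G s).toNNReal) ⟨0, hpos⟩]; exact Set.self_mem_Iic
    have hmem := hdense.open_subset_closure_inter (isOpen_Iio (a := (G s).toNNReal))
    have hmem' := closure_minimal hmem isClosed_closure hcl
    have hAs : IsClosed {t : ℝ≥0 | (s, t) ∈ A} :=
      hAc.preimage (by fun_prop : Continuous fun t : ℝ≥0 => (s, t))
    refine closure_minimal ?_ hAs hmem'
    rintro t ⟨ht, hn⟩
    by_contra hnA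
    refine hn ⟨hnA, ?_⟩
    have : t < (G s).toNNReal := ht
    calc (t : ℝ≥0∞) < (G s).toNNReal := ENNReal.coe_lt_coe.2 this
      _ = G s := ENNReal.coe_toNNReal hfin
  · rintro s ⟨-, hs⟩ s' ⟨hs', -⟩ hpos
    exact hex _ (hs hpos) _ (mem_of_fibreInf_ne_top hLc hs')

end

/-! ### Minimal densities -/

section

variable {S : Type*} [MetricSpace S] [CompactSpace S]
  {Y : Type*} [MetricSpace Y] [CompactSpace Y] {c : (S × ℝ≥0) × Y → ℝ≥0}

/-- On bounded heights, a point that is not more expensive than a nearby one is not much higher. -/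
theorem IsHeightCost.exists_modulus (hc : IsHeightCost c) (R : ℝ≥0) {η : ℝ≥0} (hη : 0 < η) :
    ∃ δ > 0, ∀ s s' t t', t' ≤ R → (∃ y, c ((s, t), y) ≤ c ((s', t'), y)) → dist s s' < δ →
      t ≤ t' + η := by
  -- Every violation of the conclusion yields a point of the compact set `K`. Strict monotonicity
  -- excludes `s = s'` there, so the distance has a positive minimum on `K`, and this is `δ`.
  set K : Set (S × S × ℝ≥0 × Y) :=
    (Set.univ ×ˢ Set.univ ×ˢ Set.Icc 0 R ×ˢ Set.univ) ∩
      {z | c ((z.1, z.2.2.1 + η), z.2.2.2) ≤ c ((z.2.1, z.2.2.1), z.2.2.2)} with hK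
  have hcc := hc.continuous
  have hKc : IsCompact K :=
    (isCompact_univ.prod (isCompact_univ.prod (isCompact_Icc.prod isCompact_univ))).inter_right
      (isClosed_le (by fun_prop) (by fun_prop))
  have hmem : ∀ s s' t t', t' ≤ R → (∃ y, c ((s, t), y) ≤ c ((s', t'), y)) → ¬ t ≤ t' + η →
      ∃ y, (s, s', t', y) ∈ K := by
    rintro s s' t t' ht ⟨y, hy⟩ hlt
    refine ⟨y, by simp [ht], ?_⟩
    exact ((hc.strictMono s y).monotone (not_le.1 hlt).le).trans hy
  rcases K.eq_empty_or_nonempty with h0 | hne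
  · refine ⟨1, one_pos, fun s s' t t' ht hy _ => ?_⟩
    by_contra hlt
    obtain ⟨y, h⟩ := hmem s s' t t' ht hy hlt
    rw [h0] at h
    exact h
  · obtain ⟨z, hz, hmin⟩ := hKc.exists_isMinOn hne
      (f := fun z : S × S × ℝ≥0 × Y => dist z.1 z.2.1) (by fun_prop)
    refine ⟨dist z.1 z.2.1, dist_pos.2 fun heq => ?_, fun s s' t t' ht hy hd => ?_⟩
    · have h2 : c ((z.1, z.2.2.1 + η), z.2.2.2) ≤ c ((z.2.1, z.2.2.1), z.2.2.2) := hz.2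
      rw [← heq] at h2
      exact absurd h2 (not_le.2 (hc.strictMono z.1 z.2.2.2 (lt_add_of_pos_right _ hη)))
    · by_contra hlt
      obtain ⟨y, h⟩ := hmem s s' t t' ht hy hlt
      exact absurd (hmin h) (not_le.2 hd)

variable [MeasurableSpace S] [BorelSpace S] [MeasurableSpace Y] [BorelSpace Y]
  {β : Measure S} [IsFiniteMeasure β]

/-- The free surfaces of optimal relaxed plans are uniformly bounded. -/
theorem IsHeightCost.exists_bound (hc : IsHeightCost c) (hβ : β ≠ 0) :
    ∃ R : ℝ≥0, ∀ g : S → ℝ≥0, Measurable g → ∫⁻ s, g s ∂β = 1 → ∀ D : Set S,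
      (∀ᵐ s ∂β, s ∈ D) →
      (∀ s ∈ D, ∀ s' ∈ D, 0 < g s → ∃ y, c ((s, g s), y) ≤ c ((s', g s'), y)) →
      ∀ s ∈ D, g s ≤ R := by
  obtain ⟨C, hC⟩ := exists_cost_le (Y := Y) hc.continuous ((β Set.univ)⁻¹).toNNReal
  obtain ⟨R, hR⟩ := hc.exists_forall_lt C
  refine ⟨R, fun g hg hg1 D hD hrel s hs => ?_⟩
  by_contra hlt
  -- Somewhere in `D` the surface is at most its mean `1 / β(S)`, where the cost is at most `C`;
  -- above `R` it exceeds `C` for every target.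
  obtain ⟨s', hs', hle⟩ := exists_notMem_null_le_laverage hβ
    hg.coe_nnreal_ennreal.aemeasurable (N := Dᶜ) hD
  rw [laverage_eq, hg1, one_div] at hle
  have hle' : g s' ≤ ((β Set.univ)⁻¹).toNNReal := by
    have := ENNReal.toNNReal_mono (ENNReal.inv_ne_top.2 (by simpa using hβ)) hle
    simpa using this
  obtain ⟨y, hy⟩ := hrel s hs s' (by simpa using hs') (zero_le.trans_lt (not_le.1 hlt))
  exact absurd (hy.trans (hC s' _ y hle')) (not_le.2 (hR s _ y (not_le.1 hlt).le))

/-- The first marginals of all optimal relaxed plans lie below graphs of functions which are, on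
sets of full measure, uniformly bounded and uniformly equicontinuous. -/
theorem IsHeightCost.exists_uniform_regularity (hc : IsHeightCost c) (hβ : β ≠ 0) :
    ∃ (R : ℝ≥0) (δ : ℝ≥0 → ℝ), (∀ η, 0 < η → 0 < δ η) ∧
      ∀ (ν : ProbabilityMeasure Y) (γ : ProbabilityMeasure ((S × ℝ≥0) × Y)),
        IsRelaxedOptimal c (cylinderMeasure β) (ν : Measure Y) γ →
        ∃ (g : S → ℝ≥0) (D : Set S), Measurable g ∧
          (γ : Measure ((S × ℝ≥0) × Y)).map Prod.fst = hypographMeasure β (fun s => g s) ∧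
          (∀ᵐ s ∂β, s ∈ D) ∧ (∀ s ∈ D, g s ≤ R) ∧
          ∀ η, 0 < η → ∀ s ∈ D, ∀ s' ∈ D, dist s s' < δ η → g s ≤ g s' + η := by
  obtain ⟨R, hR⟩ := hc.exists_bound hβ
  have hmod : ∀ η : ℝ≥0, ∃ δ : ℝ, 0 < η → 0 < δ ∧ ∀ s s' t t', t' ≤ R →
      (∃ y, c ((s, t), y) ≤ c ((s', t'), y)) → dist s s' < δ → t ≤ t' + η := by
    intro η
    by_cases hη : 0 < η
    · obtain ⟨δ, hδ, h⟩ := hc.exists_modulus R hη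
      exact ⟨δ, fun _ => ⟨hδ, h⟩⟩
    · exact ⟨0, fun h => absurd h hη⟩
  choose δ hδ using hmod
  refine ⟨R, δ, fun η hη => (hδ η hη).1, fun ν γ hγ => ?_⟩
  obtain ⟨g, hg, hgγ, D, hD, hrel⟩ := hγ.exists_hypograph hc
  have hg1 : ∫⁻ s, g s ∂β = 1 := by
    have h1 := hypographMeasure_univ β (p := fun s => (g s : ℝ)) hg.coe_nnreal_real
    rw [← hgγ, Measure.map_apply measurable_fst MeasurableSet.univ, Set.preimage_univ,
      measure_univ] at h1
    simpa using h1.symm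
  have hbd := hR g hg hg1 D hD hrel
  refine ⟨g, D, hg, hgγ, hD, hbd, fun η hη s hs s' hs' hd => ?_⟩
  rcases eq_or_lt_of_le (zero_le (a := g s)) with h0 | hpos
  · rw [← h0]; exact zero_le
  · exact (hδ η hη).2 s s' _ _ (hbd s' hs') (hrel s hs s' hs' hpos) hd

/-- Optimal relaxed plans have the same first marginal. -/
theorem IsRelaxedOptimal.map_fst_eq (hc : IsHeightCost c) {ν : Measure Y} [IsProbabilityMeasure ν]
    {γ₁ γ₂ : ProbabilityMeasure ((S × ℝ≥0) × Y)}
    (h₁ : IsRelaxedOptimal c (cylinderMeasure β) ν γ₁)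
    (h₂ : IsRelaxedOptimal c (cylinderMeasure β) ν γ₂) :
    (γ₁ : Measure ((S × ℝ≥0) × Y)).map Prod.fst = (γ₂ : Measure ((S × ℝ≥0) × Y)).map Prod.fst := by
  have hcost : planCost c γ₁ = planCost c γ₂ := le_antisymm (h₁.le _ h₂.mem) (h₂.le _ h₁.mem)
  set μ : Measure ((S × ℝ≥0) × Y) := (2 : ℝ≥0∞)⁻¹ • (γ₁ : Measure ((S × ℝ≥0) × Y)) +
    (2 : ℝ≥0∞)⁻¹ • (γ₂ : Measure ((S × ℝ≥0) × Y)) with hμ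
  have hprob : IsProbabilityMeasure μ := ⟨by simp [hμ, ENNReal.inv_two_add_inv_two]⟩
  have hfst : μ.map Prod.fst = (2 : ℝ≥0∞)⁻¹ • (γ₁ : Measure ((S × ℝ≥0) × Y)).map Prod.fst +
      (2 : ℝ≥0∞)⁻¹ • (γ₂ : Measure ((S × ℝ≥0) × Y)).map Prod.fst := by
    rw [hμ, Measure.map_add _ _ measurable_fst, Measure.map_smul, Measure.map_smul]
  have hhalf : ∀ a : ℝ≥0∞, (2 : ℝ≥0∞)⁻¹ * a + (2 : ℝ≥0∞)⁻¹ * a = a := fun a => by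
    rw [← add_mul, ENNReal.inv_two_add_inv_two, one_mul]
  have hopt : IsRelaxedOptimal c (cylinderMeasure β) ν ⟨μ, hprob⟩ := by
    have hc3 : planCost c ⟨μ, hprob⟩ = planCost c γ₁ := by
      change ∫⁻ z, c z ∂μ = _
      rw [hμ, lintegral_add_measure, lintegral_smul_measure, lintegral_smul_measure]
      change (2 : ℝ≥0∞)⁻¹ * planCost c γ₁ + (2 : ℝ≥0∞)⁻¹ * planCost c γ₂ = _
      rw [← hcost, hhalf]
    refine ⟨⟨?_, ?_⟩, fun γ' h' => hc3.trans_le (h₁.le γ' h'), hc3 ▸ h₁.ne_top⟩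
    · change μ.map Prod.fst ≤ _
      rw [hfst]
      refine Measure.le_iff'.2 fun s => ?_
      rw [← hhalf (cylinderMeasure β s)]
      simp only [Measure.add_apply, Measure.smul_apply, smul_eq_mul]
      gcongr
      · exact h₁.mem.1
      · exact h₂.mem.1
    · change μ.map Prod.snd = _
      rw [hμ, Measure.map_add _ _ measurable_snd, Measure.map_smul, Measure.map_smul, h₁.mem.2,
        h₂.mem.2, ← add_smul, ENNReal.inv_two_add_inv_two, one_smul]
  obtain ⟨g₁, hg₁, he₁, -⟩ := h₁.exists_hypograph hc
  obtain ⟨g₂, hg₂, he₂, -⟩ := h₂.exists_hypograph hc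
  obtain ⟨g₃, hg₃, he₃, -⟩ := hopt.exists_hypograph hc
  have hH₁ := measurableSet_hypograph (p := fun s => (g₁ s : ℝ)) hg₁.coe_nnreal_real
  have hH₂ := measurableSet_hypograph (p := fun s => (g₂ s : ℝ)) hg₂.coe_nnreal_real
  have hH₃ := measurableSet_hypograph (p := fun s => (g₃ s : ℝ)) hg₃.coe_nnreal_real
  set H₁ := hypograph fun s => (g₁ s : ℝ)
  set H₂ := hypograph fun s => (g₂ s : ℝ)
  set H₃ := hypograph fun s => (g₃ s : ℝ)
  have he₃' : (cylinderMeasure β).restrict H₃ = (2 : ℝ≥0∞)⁻¹ • (cylinderMeasure β).restrict H₁ +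
      (2 : ℝ≥0∞)⁻¹ • (cylinderMeasure β).restrict H₂ := by
    rw [← show _ = (cylinderMeasure β).restrict H₁ from he₁,
      ← show _ = (cylinderMeasure β).restrict H₂ from he₂, ← hfst]
    exact he₃.symm
  -- On `H₁ \ H₂` the averaged measure has density one half, yet it is the restriction to `H₃`.
  -- Taking `Z` inside `H₃` gives a null set, and then `H₁ \ H₂` itself is null.
  have hval : ∀ Z, MeasurableSet Z → Z ⊆ H₁ \ H₂ →
      cylinderMeasure β (Z ∩ H₃) = (2 : ℝ≥0∞)⁻¹ * cylinderMeasure β Z := by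
    intro Z hZ hsub
    have h := congrArg (fun m => m Z) he₃'
    simp only [Measure.add_apply, Measure.smul_apply, smul_eq_mul, Measure.restrict_apply hZ] at h
    have e1 : Z ∩ H₁ = Z := Set.inter_eq_left.2 fun x hx => (hsub hx).1
    have e2 : Z ∩ H₂ = ∅ := Set.eq_empty_of_forall_notMem fun x hx => (hsub hx.1).2 hx.2
    rw [h, e1, e2, measure_empty, mul_zero, add_zero]
  have hfin : cylinderMeasure β H₁ ≠ ∞ := by
    have : cylinderMeasure β H₁ = 1 := by
      rw [← Measure.restrict_apply_univ, show (cylinderMeasure β).restrict H₁ = _ from he₁.symm,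
        Measure.map_apply measurable_fst MeasurableSet.univ, Set.preimage_univ, measure_univ]
    simp [this]
  have hZ3 : cylinderMeasure β (H₁ \ H₂ ∩ H₃) = 0 := by
    have h := hval (H₁ \ H₂ ∩ H₃) ((hH₁.diff hH₂).inter hH₃) Set.inter_subset_left
    rw [Set.inter_assoc, Set.inter_self] at h
    by_contra hne
    have hlt : cylinderMeasure β (H₁ \ H₂ ∩ H₃) ≠ ∞ := ne_top_of_le_ne_top hfin
      (measure_mono (Set.inter_subset_left.trans Set.sdiff_subset))
    have := ENNReal.half_lt_self hne hlt
    rw [ENNReal.div_eq_inv_mul, ← h] at this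
    exact lt_irrefl _ this
  have hZ : cylinderMeasure β (H₁ \ H₂) = 0 := by
    have h := hval (H₁ \ H₂) (hH₁.diff hH₂) subset_rfl
    rw [hZ3, eq_comm, mul_eq_zero] at h
    exact h.resolve_left (by simp)
  have hle : (γ₁ : Measure ((S × ℝ≥0) × Y)).map Prod.fst
      ≤ (γ₂ : Measure ((S × ℝ≥0) × Y)).map Prod.fst := by
    rw [he₁, he₂]
    exact Measure.restrict_mono_ae (ae_le_set.2 hZ)
  have i₁ : IsProbabilityMeasure ((γ₁ : Measure ((S × ℝ≥0) × Y)).map Prod.fst) :=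
    Measure.isProbabilityMeasure_map measurable_fst.aemeasurable
  have i₂ : IsProbabilityMeasure ((γ₂ : Measure ((S × ℝ≥0) × Y)).map Prod.fst) :=
    Measure.isProbabilityMeasure_map measurable_fst.aemeasurable
  exact Measure.eq_of_le_of_measure_univ_eq hle (by rw [measure_univ, measure_univ])

/-! ### Minimal densities as first marginals of optimal relaxed plans -/

variable (c β)

/-- Measurable probability densities with respect to `β`. -/
structure IsDensity (p : S → ℝ) : Prop where
  measurable : Measurable p
  nonneg : 0 ≤ᵐ[β] p
  lintegral_eq_one : ∫⁻ s, ENNReal.ofReal (p s) ∂β = 1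

/-- Densities whose hypograph has minimal transport cost to `ν`. -/
structure IsMinimalDensity (ν : Measure Y) (p : S → ℝ) : Prop where
  isDensity : IsDensity β p
  le : ∀ q, IsDensity β q →
    transportCost c (hypographMeasure β p) ν ≤ transportCost c (hypographMeasure β q) ν

variable {c β}

theorem hypographMeasure_le (p : S → ℝ) : hypographMeasure β p ≤ cylinderMeasure β :=
  Measure.restrict_le_self

theorem transportPlans_subset_relaxedPlans (p : S → ℝ) (ν : Measure Y) :
    transportPlans (hypographMeasure β p) ν ⊆ relaxedPlans (cylinderMeasure β) ν :=
  fun _ h => ⟨h.1.trans_le (hypographMeasure_le p), h.2⟩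

/-- The flat competitor, whose cost is bounded independently of the target. -/
theorem isDensity_const (hβ : β ≠ 0) : IsDensity β fun _ => ((β Set.univ)⁻¹).toReal := by
  have h0 : β Set.univ ≠ 0 := by simpa using hβ
  refine ⟨measurable_const, Eventually.of_forall fun s => ENNReal.toReal_nonneg, ?_⟩
  rw [lintegral_const, ENNReal.ofReal_toReal (ENNReal.inv_ne_top.2 h0),
    ENNReal.inv_mul_cancel h0 (measure_ne_top _ _)]

theorem IsHeightCost.exists_isRelaxedOptimal (hc : IsHeightCost c) (hβ : β ≠ 0)
    (ν : ProbabilityMeasure Y) :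
    ∃ γ, IsRelaxedOptimal c (cylinderMeasure β) (ν : Measure Y) γ := by
  have hd := isDensity_const hβ
  have hT := transportCost_ne_top (R := ((β Set.univ)⁻¹).toNNReal) β hc.continuous hd.measurable
    hd.lintegral_eq_one (Eventually.of_forall fun s => le_rfl) ν
  obtain ⟨γ₀, h₀⟩ := iInf_lt_iff.1 (lt_top_iff_ne_top.2 hT)
  obtain ⟨hmem, hlt⟩ := iInf_lt_iff.1 h₀
  have hmem' := transportPlans_subset_relaxedPlans _ _ hmem
  obtain ⟨γ, hγ, hmin⟩ := hc.exists_forall_planCost_le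
    (isClosed_relaxedPlans (cylinderMeasure β) ν) hmem' hlt.ne
  exact ⟨γ, hγ, hmin, ne_top_of_le_ne_top hlt.ne (hmin _ hmem')⟩

theorem IsRelaxedOptimal.le_transportCost {ν : Measure Y}
    {γ : ProbabilityMeasure ((S × ℝ≥0) × Y)} (h : IsRelaxedOptimal c (cylinderMeasure β) ν γ)
    (p : S → ℝ) : planCost c γ ≤ transportCost c (hypographMeasure β p) ν :=
  le_iInf₂ fun γ' h' => h.le γ' (transportPlans_subset_relaxedPlans p ν h')

theorem IsRelaxedOptimal.transportCost_eq {ν : Measure Y}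
    {γ : ProbabilityMeasure ((S × ℝ≥0) × Y)} (h : IsRelaxedOptimal c (cylinderMeasure β) ν γ)
    {p : S → ℝ} (hp : (γ : Measure ((S × ℝ≥0) × Y)).map Prod.fst = hypographMeasure β p) :
    transportCost c (hypographMeasure β p) ν = planCost c γ :=
  le_antisymm (iInf₂_le γ ⟨hp, h.mem.2⟩) (h.le_transportCost p)

theorem isDensity_of_map_fst_eq {γ : ProbabilityMeasure ((S × ℝ≥0) × Y)} {g : S → ℝ≥0}
    (hg : Measurable g)
    (h : (γ : Measure ((S × ℝ≥0) × Y)).map Prod.fst = hypographMeasure β (fun s => g s)) :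
    IsDensity β fun s => (g s : ℝ) := by
  refine ⟨hg.coe_nnreal_real, Eventually.of_forall fun s => (g s).2, ?_⟩
  rw [← hypographMeasure_univ β hg.coe_nnreal_real, ← h,
    Measure.map_apply measurable_fst MeasurableSet.univ, Set.preimage_univ, measure_univ]

theorem IsRelaxedOptimal.isMinimalDensity {ν : Measure Y}
    {γ : ProbabilityMeasure ((S × ℝ≥0) × Y)} (h : IsRelaxedOptimal c (cylinderMeasure β) ν γ)
    {g : S → ℝ≥0} (hg : Measurable g)
    (hp : (γ : Measure ((S × ℝ≥0) × Y)).map Prod.fst = hypographMeasure β (fun s => g s)) :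
    IsMinimalDensity c β ν fun s => (g s : ℝ) :=
  ⟨isDensity_of_map_fst_eq hg hp,
    fun q _ => (h.transportCost_eq hp).trans_le (h.le_transportCost q)⟩

/-- The relaxation is exact: the free surface of `γ` is itself an admissible density. -/
theorem IsMinimalDensity.transportCost_eq (hc : IsHeightCost c) {ν : ProbabilityMeasure Y}
    {p : S → ℝ} (hp : IsMinimalDensity c β (ν : Measure Y) p)
    {γ : ProbabilityMeasure ((S × ℝ≥0) × Y)}
    (h : IsRelaxedOptimal c (cylinderMeasure β) (ν : Measure Y) γ) :
    transportCost c (hypographMeasure β p) (ν : Measure Y) = planCost c γ := by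
  obtain ⟨g, hg, hgγ, -⟩ := h.exists_hypograph hc
  refine le_antisymm ?_ (h.le_transportCost p)
  rw [← h.transportCost_eq hgγ]
  exact hp.le _ (isDensity_of_map_fst_eq hg hgγ)

/-- Optimal transport plans of minimal densities are optimal relaxed plans. -/
theorem IsMinimalDensity.isRelaxedOptimal (hc : IsHeightCost c) (hβ : β ≠ 0)
    {ν : ProbabilityMeasure Y} {p : S → ℝ} (hp : IsMinimalDensity c β (ν : Measure Y) p)
    {γ : ProbabilityMeasure ((S × ℝ≥0) × Y)}
    (h : IsOptimalPlan c (hypographMeasure β p) (ν : Measure Y) γ) :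
    IsRelaxedOptimal c (cylinderMeasure β) (ν : Measure Y) γ := by
  obtain ⟨γ', h'⟩ := hc.exists_isRelaxedOptimal hβ ν
  have heq : planCost c γ = planCost c γ' := h.2.trans (hp.transportCost_eq hc h')
  exact ⟨transportPlans_subset_relaxedPlans p _ h.1, fun γ'' h'' => heq.trans_le (h'.le γ'' h''),
    heq ▸ h'.ne_top⟩

/-- Minimal densities have optimal transport plans. -/
theorem IsMinimalDensity.exists_isOptimalPlan (hc : IsHeightCost c) (hβ : β ≠ 0)
    {ν : ProbabilityMeasure Y} {p : S → ℝ} (hp : IsMinimalDensity c β (ν : Measure Y) p) :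
    ∃ γ, IsOptimalPlan c (hypographMeasure β p) (ν : Measure Y) γ := by
  obtain ⟨γ', h'⟩ := hc.exists_isRelaxedOptimal hβ ν
  have hT : transportCost c (hypographMeasure β p) (ν : Measure Y) < ∞ := by
    rw [hp.transportCost_eq hc h']; exact h'.ne_top.lt_top
  have hprob := isProbabilityMeasure_hypographMeasure β hp.isDensity.measurable
    hp.isDensity.lintegral_eq_one
  -- Between probability measures domination is equality, so closedness of relaxed plans applies to
  -- exact plans too.
  have heq : relaxedPlans (hypographMeasure β p) (ν : Measure Y)
      = transportPlans (hypographMeasure β p) (ν : Measure Y) := by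
    ext γ
    have hγ : IsProbabilityMeasure ((γ : Measure ((S × ℝ≥0) × Y)).map Prod.fst) :=
      Measure.isProbabilityMeasure_map measurable_fst.aemeasurable
    exact ⟨fun h => ⟨Measure.eq_of_le_of_measure_univ_eq h.1 (by rw [measure_univ, measure_univ]),
      h.2⟩, fun h => ⟨h.1.le, h.2⟩⟩
  obtain ⟨γ₀, h₀⟩ := iInf_lt_iff.1 hT
  obtain ⟨hmem, hlt⟩ := iInf_lt_iff.1 h₀
  have hcl := isClosed_relaxedPlans (hypographMeasure β p) ν
  rw [heq] at hcl
  obtain ⟨γ, hγ, hmin⟩ := hc.exists_forall_planCost_le hcl hmem hlt.ne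
  exact ⟨γ, hγ, le_antisymm (le_iInf₂ hmin) (iInf₂_le γ hγ)⟩

theorem IsHeightCost.exists_isMinimalDensity (hc : IsHeightCost c) (hβ : β ≠ 0)
    (ν : ProbabilityMeasure Y) : ∃ p, IsMinimalDensity c β (ν : Measure Y) p := by
  obtain ⟨γ, h⟩ := hc.exists_isRelaxedOptimal hβ ν
  obtain ⟨g, hg, hgγ, -⟩ := h.exists_hypograph hc
  exact ⟨_, h.isMinimalDensity hg hgγ⟩

/-- The first marginal of an optimal relaxed plan is the hypograph of the minimal density. -/
theorem IsMinimalDensity.map_fst_eq (hc : IsHeightCost c) (hβ : β ≠ 0)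
    {ν : ProbabilityMeasure Y} {p : S → ℝ} (hp : IsMinimalDensity c β (ν : Measure Y) p)
    {γ : ProbabilityMeasure ((S × ℝ≥0) × Y)}
    (h : IsRelaxedOptimal c (cylinderMeasure β) (ν : Measure Y) γ) :
    (γ : Measure ((S × ℝ≥0) × Y)).map Prod.fst = hypographMeasure β p := by
  obtain ⟨γ', h'⟩ := hp.exists_isOptimalPlan hc hβ
  rw [h.map_fst_eq hc (hp.isRelaxedOptimal hc hβ h'), h'.1.1]

theorem IsMinimalDensity.ae_eq (hc : IsHeightCost c) (hβ : β ≠ 0)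
    {ν : ProbabilityMeasure Y} {p q : S → ℝ} (hp : IsMinimalDensity c β (ν : Measure Y) p)
    (hq : IsMinimalDensity c β (ν : Measure Y) q) : p =ᵐ[β] q := by
  obtain ⟨γ, h⟩ := hc.exists_isRelaxedOptimal hβ ν
  exact ae_eq_of_hypographMeasure_eq β hp.isDensity.measurable hq.isDensity.measurable
    hp.isDensity.nonneg hq.isDensity.nonneg
    ((hp.map_fst_eq hc hβ h).symm.trans (hq.map_fst_eq hc hβ h))

end

/-! ### Extension of uniformly continuous functions -/

/-- A uniformly continuous function on a subset extends to the whole space without increasing its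
bounds. -/
theorem exists_continuous_extension {S : Type*} [MetricSpace S] [CompactSpace S] {D : Set S}
    {u : S → ℝ} (hu : UniformContinuousOn u D) :
    ∃ v : S → ℝ, Continuous v ∧ (∀ s ∈ D, v s = u s) ∧
      ∀ M, 0 ≤ M → (∀ s ∈ D, |u s| ≤ M) → ∀ s, |v s| ≤ M := by
  have hlim : ∀ x ∈ closure D, ∃ y, Tendsto u (𝓝[D] x) (𝓝 y) := by
    intro x hx
    have : (𝓝[D] x).NeBot := mem_closure_iff_nhdsWithin_neBot.1 hx
    exact CompleteSpace.complete
      ((cauchy_nhds.mono nhdsWithin_le_nhds).map_of_le hu inf_le_right)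
  have hcont : ContinuousOn (extendFrom D u) (closure D) := continuousOn_extendFrom subset_rfl hlim
  have : CompactSpace (closure D) := isCompact_iff_compactSpace.1 isClosed_closure.isCompact
  set f : BoundedContinuousFunction (closure D) ℝ :=
    BoundedContinuousFunction.mkOfCompact ⟨(closure D).domRestrict (extendFrom D u),
      hcont.domRestrict⟩ with hf
  -- Norm-preserving Tietze extension from the closure of `D`, where bounds on `D` persist by
  -- density.
  obtain ⟨g, hg, hgf⟩ :=
    BoundedContinuousFunction.exists_norm_eq_domRestrict_eq_of_closed f isClosed_closure
  refine ⟨g, g.continuous, fun s hs => ?_, fun M hM h s => ?_⟩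
  · have h1 := DFunLike.congr_fun hgf ⟨s, subset_closure hs⟩
    have : (𝓝[D] s).NeBot := mem_closure_iff_nhdsWithin_neBot.1 (subset_closure hs)
    have h2 : extendFrom D u s = u s :=
      tendsto_nhds_unique (tendsto_extendFrom (hlim s (subset_closure hs))) (hu.continuousOn s hs)
    rw [← h2]
    exact h1
  · refine (g.norm_coe_le_norm s).trans ?_
    rw [hg, BoundedContinuousFunction.norm_le hM]
    rintro ⟨x, hx⟩
    have : (𝓝[D] x).NeBot := mem_closure_iff_nhdsWithin_neBot.1 hx
    have h1 : Tendsto (fun s => ‖u s‖) (𝓝[D] x) (𝓝 ‖extendFrom D u x‖) :=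
      (tendsto_extendFrom (hlim x hx)).norm
    exact le_of_tendsto h1 (eventually_nhdsWithin_of_forall fun s hs => h s hs)

/-- Uniformly continuous functions on a subset which converge uniformly there have uniformly
convergent continuous extensions. -/
theorem exists_tendstoUniformly_extension {S : Type*} [MetricSpace S] [CompactSpace S] {D : Set S}
    {u : ℕ → S → ℝ} {u₀ : S → ℝ} (hu : ∀ n, UniformContinuousOn (u n) D)
    (hu₀ : UniformContinuousOn u₀ D) (hlim : TendstoUniformlyOn u u₀ atTop D) :
    ∃ (v : ℕ → S → ℝ) (v₀ : S → ℝ), (∀ n, Continuous (v n) ∧ ∀ s ∈ D, v n s = u n s) ∧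
      (Continuous v₀ ∧ ∀ s ∈ D, v₀ s = u₀ s) ∧ TendstoUniformly v v₀ atTop := by
  obtain ⟨v₀, hv₀, hv₀u, -⟩ := exists_continuous_extension hu₀
  -- Extending the differences, not the `u n`, carries their uniform smallness over to points
  -- outside the closure of `D`.
  have hw : ∀ n, UniformContinuousOn (fun s => u n s - u₀ s) D := fun n => by
    rw [uniformContinuousOn_iff_restrict] at hu₀ ⊢
    exact (uniformContinuousOn_iff_restrict.1 (hu n)).sub hu₀
  choose w hw hwu hwb using fun n => exists_continuous_extension (hw n)
  refine ⟨fun n s => v₀ s + w n s, v₀, fun n => ⟨hv₀.add (hw n), fun s hs => ?_⟩, ⟨hv₀, hv₀u⟩, ?_⟩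
  · dsimp only
    rw [hv₀u s hs, hwu n s hs]; ring
  · rw [Metric.tendstoUniformly_iff]
    rw [Metric.tendstoUniformlyOn_iff] at hlim
    intro ε hε
    filter_upwards [hlim (ε / 2) (half_pos hε)] with n hn s
    have := hwb n (ε / 2) (half_pos hε).le (fun s hs => by
      have := hn s hs
      rw [dist_comm, Real.dist_eq] at this
      exact this.le) s
    rw [dist_comm, Real.dist_eq, add_sub_cancel_left]
    linarith

/-! ### Stability -/

section

variable {S : Type*} [MetricSpace S] [CompactSpace S] [MeasurableSpace S] [BorelSpace S]
  {Y : Type*} [MetricSpace Y] [CompactSpace Y] [MeasurableSpace Y] [BorelSpace Y]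
  {c : (S × ℝ≥0) × Y → ℝ≥0} {β : Measure S} [IsFiniteMeasure β]

theorem IsHeightCost.exists_planCost_le (hc : IsHeightCost c) (hβ : β ≠ 0) :
    ∃ C : ℝ≥0, ∀ (ν : ProbabilityMeasure Y) γ,
      IsRelaxedOptimal c (cylinderMeasure β) (ν : Measure Y) γ → planCost c γ ≤ C := by
  have hd := isDensity_const hβ
  obtain ⟨C, hC⟩ := exists_cost_le (Y := Y) hc.continuous ((β Set.univ)⁻¹).toNNReal
  have := isProbabilityMeasure_hypographMeasure β hd.measurable hd.lintegral_eq_one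
  refine ⟨C, fun ν γ h => (h.le_transportCost
    fun _ => ((β Set.univ)⁻¹).toReal).trans (transportCost_le_const c ?_)⟩
  filter_upwards [hypographMeasure_ae_le β hd.measurable (R := ((β Set.univ)⁻¹).toReal)
    (Eventually.of_forall fun s => le_rfl)] with x hx y
  exact hC x.1 x.2 y hx

/-- Minimal densities are essentially bounded. -/
theorem IsMinimalDensity.exists_ae_le (hc : IsHeightCost c) (hβ : β ≠ 0)
    {ν : ProbabilityMeasure Y} {p : S → ℝ} (hp : IsMinimalDensity c β (ν : Measure Y) p) :
    ∃ R : ℝ≥0, ∀ᵐ s ∂β, p s ≤ R := by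
  obtain ⟨R, δ, -, h⟩ := hc.exists_uniform_regularity hβ
  obtain ⟨γ, hγ⟩ := hc.exists_isRelaxedOptimal hβ ν
  obtain ⟨g, D, hg, hgγ, hD, hbd, -⟩ := h ν γ hγ
  refine ⟨R, ?_⟩
  filter_upwards [hD, hp.ae_eq hc hβ (hγ.isMinimalDensity hg hgγ)] with s hs heq
  rw [heq]
  exact_mod_cast hbd s hs

/-- Optimal relaxed plans are compact under weak convergence of the target. -/
theorem exists_subseq_tendsto_isRelaxedOptimal (hc : IsHeightCost c) (hβ : β ≠ 0)
    {ν : ℕ → ProbabilityMeasure Y} {ν₀ : ProbabilityMeasure Y} (hν : Tendsto ν atTop (𝓝 ν₀))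
    {γ : ℕ → ProbabilityMeasure ((S × ℝ≥0) × Y)}
    (hγ : ∀ n, IsRelaxedOptimal c (cylinderMeasure β) (ν n : Measure Y) (γ n)) :
    ∃ (φ : ℕ → ℕ) (γ₀ : ProbabilityMeasure ((S × ℝ≥0) × Y)), StrictMono φ ∧
      IsRelaxedOptimal c (cylinderMeasure β) (ν₀ : Measure Y) γ₀ ∧
      Tendsto (γ ∘ φ) atTop (𝓝 γ₀) := by
  obtain ⟨C, hC⟩ := hc.exists_planCost_le hβ
  obtain ⟨γ₀, hγ₀C, φ, hφ, hlim⟩ := (hc.isCompact_setOf_planCost_le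
    (ENNReal.coe_ne_top (r := C))).tendsto_subseq fun n => hC (ν n) (γ n) (hγ n)
  have hνφ : Tendsto (ν ∘ φ) atTop (𝓝 ν₀) := hν.comp hφ.tendsto_atTop
  obtain ⟨γ', hγ'⟩ := hc.exists_isRelaxedOptimal hβ ν₀
  obtain ⟨p, hp⟩ := hc.exists_isMinimalDensity hβ ν₀
  obtain ⟨R, hR⟩ := hp.exists_ae_le hc hβ
  -- The minimal density of the limit problem serves as a fixed competitor along the sequence; its
  -- cost tends to the limit minimum.
  have hT := tendsto_transportCost_hypograph β hc.continuous (p := fun _ : ℕ => p)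
    (fun _ => hp.isDensity.measurable) hp.isDensity.measurable
    (fun _ => hp.isDensity.lintegral_eq_one) hp.isDensity.lintegral_eq_one hR
    (fun η _ => Eventually.of_forall fun _ => Eventually.of_forall fun s => by simp) hνφ
  rw [hp.transportCost_eq hc hγ'] at hT
  have hle : planCost c γ₀ ≤ planCost c γ' := by
    by_contra! hlt
    obtain ⟨b, hb1, hb2⟩ := exists_between hlt
    have e1 := hT.eventually_lt_const hb1
    have e2 := hlim.eventually (lowerSemicontinuous_planCost hc.continuous γ₀ b hb2)
    obtain ⟨k, h1, h2⟩ := (e1.and e2).exists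
    exact lt_irrefl _ (h2.trans (((hγ (φ k)).le_transportCost p).trans_lt h1))
  exact ⟨φ, γ₀, hφ, ⟨mem_relaxedPlans_of_tendsto hlim hνφ fun k => (hγ (φ k)).mem,
    fun γ'' h'' => hle.trans (hγ'.le γ'' h''), ne_top_of_le_ne_top hγ'.ne_top hle⟩, hlim⟩

/-- The part of the hypographs of minimal densities outside the limit hypograph vanishes. -/
theorem tendsto_cylinderMeasure_hypograph_diff (hc : IsHeightCost c) (hβ : β ≠ 0)
    {ν : ℕ → ProbabilityMeasure Y} {ν₀ : ProbabilityMeasure Y} (hν : Tendsto ν atTop (𝓝 ν₀))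
    {p : ℕ → S → ℝ} {p₀ : S → ℝ} (hp : ∀ n, IsMinimalDensity c β (ν n : Measure Y) (p n))
    (hp₀ : IsMinimalDensity c β (ν₀ : Measure Y) p₀) :
    Tendsto (fun n => cylinderMeasure β (hypograph (p n) \ hypograph p₀)) atTop (𝓝 0) := by
  choose γ hγ using fun n => hc.exists_isRelaxedOptimal hβ (ν n)
  obtain ⟨γ₀, hγ₀⟩ := hc.exists_isRelaxedOptimal hβ ν₀
  have hfst : ∀ {ν : ProbabilityMeasure Y} {p : S → ℝ} {γ : ProbabilityMeasure ((S × ℝ≥0) × Y)},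
      IsMinimalDensity c β (ν : Measure Y) p →
      IsRelaxedOptimal c (cylinderMeasure β) (ν : Measure Y) γ →
      ((γ.map continuous_fst.measurable.aemeasurable : ProbabilityMeasure (S × ℝ≥0)) :
        Measure (S × ℝ≥0)) = hypographMeasure β p := fun hp h => hp.map_fst_eq hc hβ h
  have hlim : Tendsto (fun n => (γ n).map continuous_fst.measurable.aemeasurable) atTop
      (𝓝 (γ₀.map continuous_fst.measurable.aemeasurable)) := by
    -- Subsequential limit plans may differ, but they all share one first marginal.
    refine tendsto_of_subseq_tendsto fun ns hns => ?_
    obtain ⟨φ, γ', hφ, hγ', hlim⟩ := exists_subseq_tendsto_isRelaxedOptimal hc hβ (hν.comp hns)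
      (γ := fun n => γ (ns n)) fun n => hγ (ns n)
    refine ⟨φ, ?_⟩
    have h1 := ProbabilityMeasure.tendsto_map_of_tendsto_of_continuous _ _ hlim continuous_fst
    have heq : γ'.map continuous_fst.measurable.aemeasurable
        = γ₀.map continuous_fst.measurable.aemeasurable :=
      Subtype.ext ((hfst hp₀ hγ').trans (hfst hp₀ hγ₀).symm)
    rw [← heq]
    exact h1
  have hm₀ := measurableSet_hypograph hp₀.isDensity.measurable
  have hfin : cylinderMeasure β (hypograph p₀) ≠ ∞ := by
    rw [cylinderMeasure_hypograph β hp₀.isDensity.measurable, hp₀.isDensity.lintegral_eq_one]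
    exact ENNReal.one_ne_top
  rw [ENNReal.tendsto_nhds_zero]
  intro ε hε
  -- The limit marginal vanishes on the closed set `Uᶜ`, so the portmanteau theorem makes the mass
  -- there small; the rest lies in the thin set `U \ hypograph p₀`.
  obtain ⟨U, hU, hUo, -, hUε⟩ := hm₀.exists_isOpen_sdiff_lt hfin (ENNReal.half_pos hε.ne').ne'
  have hclosed := ProbabilityMeasure.limsup_measure_closed_le_of_tendsto hlim hUo.isClosed_compl
  have hzero : ((γ₀.map continuous_fst.measurable.aemeasurable : ProbabilityMeasure (S × ℝ≥0)) :
      Measure (S × ℝ≥0)) Uᶜ = 0 := by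
    rw [hfst hp₀ hγ₀, hypographMeasure, Measure.restrict_apply hUo.isClosed_compl.measurableSet,
      Set.inter_comm, ← Set.sdiff_eq, Set.sdiff_eq_empty.2 hU, measure_empty]
  rw [hzero] at hclosed
  have hev := eventually_lt_of_limsup_lt (hclosed.trans_lt (ENNReal.half_pos hε.ne'))
  filter_upwards [hev] with n hn
  rw [hfst (hp n) (hγ n), hypographMeasure,
    Measure.restrict_apply hUo.isClosed_compl.measurableSet] at hn
  have hsub : hypograph (p n) \ hypograph p₀ ⊆ (Uᶜ ∩ hypograph (p n)) ∪ (U \ hypograph p₀) := by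
    intro x hx
    by_cases hxU : x ∈ U
    · exact Or.inr ⟨hxU, hx.2⟩
    · exact Or.inl ⟨hxU, hx.1⟩
  calc _ ≤ _ := (measure_mono hsub).trans (measure_union_le _ _)
    _ ≤ ε / 2 + ε / 2 := add_le_add hn.le hUε.le
    _ = ε := ENNReal.add_halves ε

/-- Both hypographs have measure one and the same intersection. -/
theorem cylinderMeasure_hypograph_diff_comm {p q : S → ℝ} (hp : IsDensity β p)
    (hq : IsDensity β q) : cylinderMeasure β (hypograph p \ hypograph q)
      = cylinderMeasure β (hypograph q \ hypograph p) := by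
  have h1 : ∀ {p : S → ℝ}, IsDensity β p → cylinderMeasure β (hypograph p) = 1 := fun hp => by
    rw [cylinderMeasure_hypograph β hp.measurable, hp.lintegral_eq_one]
  have hpm := measurableSet_hypograph hp.measurable
  have hqm := measurableSet_hypograph hq.measurable
  have e1 := measure_sdiff_add_inter (μ := cylinderMeasure β) (hypograph p) hqm
  have e2 := measure_sdiff_add_inter (μ := cylinderMeasure β) (hypograph q) hpm
  rw [h1 hp] at e1
  rw [h1 hq, Set.inter_comm, ← e1] at e2
  refine (ENNReal.add_left_inj (ne_top_of_le_ne_top ENNReal.one_ne_top ?_)).1 e2.symm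
  rw [← h1 hp]
  exact measure_mono Set.inter_subset_left

/-- The indicators of the hypographs of minimal densities converge in `L¹`. -/
theorem tendsto_eLpNorm_indicator_hypograph (hc : IsHeightCost c) (hβ : β ≠ 0)
    {ν : ℕ → ProbabilityMeasure Y} {ν₀ : ProbabilityMeasure Y} (hν : Tendsto ν atTop (𝓝 ν₀))
    {p : ℕ → S → ℝ} {p₀ : S → ℝ} (hp : ∀ n, IsMinimalDensity c β (ν n : Measure Y) (p n))
    (hp₀ : IsMinimalDensity c β (ν₀ : Measure Y) p₀) :
    Tendsto (fun n => eLpNorm ((hypograph (p n)).indicator (1 : S × ℝ≥0 → ℝ) -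
      (hypograph p₀).indicator 1) 1 (cylinderMeasure β)) atTop (𝓝 0) := by
  have h0 := tendsto_cylinderMeasure_hypograph_diff hc hβ hν hp hp₀
  have h2 : Tendsto (fun n => cylinderMeasure β (hypograph (p n) \ hypograph p₀) +
      cylinderMeasure β (hypograph (p n) \ hypograph p₀)) atTop (𝓝 0) := by
    simpa using h0.add h0
  refine tendsto_of_tendsto_of_tendsto_of_le_of_le tendsto_const_nhds h2 (fun n => zero_le)
    fun n => ?_
  have hm := measurableSet_hypograph (hp n).isDensity.measurable
  have hm₀ := measurableSet_hypograph hp₀.isDensity.measurable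
  dsimp only
  -- One of the two equal summands is replaced by the opposite difference, so that together they
  -- integrate the indicator of the symmetric difference.
  conv_rhs =>
    rw [← lintegral_indicator_one (hm.diff hm₀)]
    arg 2
    rw [lintegral_indicator_one (hm.diff hm₀),
      cylinderMeasure_hypograph_diff_comm (hp n).isDensity hp₀.isDensity,
      ← lintegral_indicator_one (hm₀.diff hm)]
  rw [← lintegral_add_left (measurable_one.indicator (hm.diff hm₀)), eLpNorm_one_eq_lintegral_enorm]
  refine lintegral_mono fun x => ?_
  by_cases h1 : x ∈ hypograph (p n) <;> by_cases h2 : x ∈ hypograph p₀ <;> simp [h1, h2]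

/-- Pointwise comparison of equicontinuous functions through the measure between their graphs. -/
theorem le_add_of_cylinderMeasure_diff_lt {g h : S → ℝ≥0} (hg : Measurable g) (hh : Measurable h)
    {D : Set S} (hD : ∀ᵐ s ∂β, s ∈ D) {η : ℝ≥0} {B : Set S}
    (hgB : ∀ s ∈ D ∩ B, ∀ s' ∈ D ∩ B, g s ≤ g s' + η)
    (hhB : ∀ s ∈ D ∩ B, ∀ s' ∈ D ∩ B, h s ≤ h s' + η)
    (hlt : cylinderMeasure β (hypograph (fun s => (h s : ℝ)) \ hypograph fun s => (g s : ℝ))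
      < η * β B) {s : S} (hs : s ∈ D ∩ B) : h s ≤ g s + 3 * η := by
  -- A gap above `3 * η` at `s`, less one oscillation `η` of each function, leaves a gap of at least
  -- `η` on almost all of `B`.
  by_contra! hcon
  refine absurd hlt (not_lt.2 ?_)
  rw [cylinderMeasure_hypograph_diff β hh.coe_nnreal_real hg.coe_nnreal_real, ← setLIntegral_const]
  refine le_trans (setLIntegral_mono_ae (by fun_prop) ?_) (setLIntegral_le_lintegral B _)
  filter_upwards [hD] with s' hs' hB'
  have h1 := hhB s hs s' ⟨hs', hB'⟩
  have h2 := hgB s' ⟨hs', hB'⟩ s hs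
  simp only [ENNReal.ofReal_coe_nnreal]
  norm_cast
  refine le_tsub_of_add_le_left ?_
  rw [← NNReal.coe_le_coe] at h1 h2 ⊢
  rw [← NNReal.coe_lt_coe] at hcon
  push_cast at *
  linarith

/-- Minimal densities have continuous representatives which depend continuously on the target. -/
theorem exists_continuous_representatives (hc : IsHeightCost c) (hβ : β ≠ 0)
    {ν : ℕ → ProbabilityMeasure Y} {ν₀ : ProbabilityMeasure Y} (hν : Tendsto ν atTop (𝓝 ν₀))
    {p : ℕ → S → ℝ} {p₀ : S → ℝ} (hp : ∀ n, IsMinimalDensity c β (ν n : Measure Y) (p n))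
    (hp₀ : IsMinimalDensity c β (ν₀ : Measure Y) p₀) :
    ∃ (f : ℕ → S → ℝ) (f₀ : S → ℝ), (∀ n, Continuous (f n) ∧ p n =ᵐ[β] f n) ∧
      (Continuous f₀ ∧ p₀ =ᵐ[β] f₀) ∧ TendstoUniformly f f₀ atTop := by
  obtain ⟨R, δ, hδ, hreg⟩ := hc.exists_uniform_regularity hβ
  choose γ hγ using fun n => hc.exists_isRelaxedOptimal hβ (ν n)
  obtain ⟨γ₀, hγ₀⟩ := hc.exists_isRelaxedOptimal hβ ν₀
  choose g D hg hgγ hD hbd hmod using fun n => hreg (ν n) (γ n) (hγ n)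
  obtain ⟨g₀, D₀, hg₀, hgγ₀, hD₀, hbd₀, hmod₀⟩ := hreg ν₀ γ₀ hγ₀
  have hgm : ∀ n, IsMinimalDensity c β (ν n : Measure Y) fun s => (g n s : ℝ) := fun n =>
    (hγ n).isMinimalDensity (hg n) (hgγ n)
  have hgm₀ := hγ₀.isMinimalDensity hg₀ hgγ₀
  -- Intersecting with the support makes every ball that contains a point of `E` have positive
  -- measure.
  set E : Set S := ((⋂ n, D n) ∩ D₀) ∩ β.support with hE
  have hEae : ∀ᵐ s ∂β, s ∈ E := by
    filter_upwards [ae_all_iff.2 hD, hD₀, Measure.support_mem_ae (μ := β)] with s h1 h2 h3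
    exact ⟨⟨Set.mem_iInter.2 h1, h2⟩, h3⟩
  have hEn : ∀ n, E ⊆ D n := fun n s hs => Set.mem_iInter.1 hs.1.1 n
  have hE₀ : E ⊆ D₀ := fun s hs => hs.1.2
  have huc : ∀ {g : S → ℝ≥0} {D : Set S}, E ⊆ D →
      (∀ η, 0 < η → ∀ s ∈ D, ∀ s' ∈ D, dist s s' < δ η → g s ≤ g s' + η) →
      UniformContinuousOn (fun s => (g s : ℝ)) E := by
    intro g D hED hmod
    rw [Metric.uniformContinuousOn_iff_le]
    intro ε hε
    lift ε to ℝ≥0 using hε.le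
    have hε' : 0 < ε := by exact_mod_cast hε
    refine ⟨δ ε / 2, half_pos (hδ ε hε'), fun s hs s' hs' hd => ?_⟩
    have hd' : dist s s' < δ ε := hd.trans_lt (half_lt_self (hδ ε hε'))
    have h1 := hmod ε hε' s (hED hs) s' (hED hs') hd'
    have h2 := hmod ε hε' s' (hED hs') s (hED hs) (by rwa [dist_comm])
    rw [← NNReal.coe_le_coe] at h1 h2
    push_cast at h1 h2
    rw [Real.dist_eq, abs_le]
    constructor <;> linarith
  have hlim : TendstoUniformlyOn (fun n s => (g n s : ℝ)) (fun s => (g₀ s : ℝ)) atTop E := by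
    rw [Metric.tendstoUniformlyOn_iff]
    intro ε hε
    lift ε to ℝ≥0 using hε.le
    have hε' : 0 < ε := by exact_mod_cast hε
    set η : ℝ≥0 := ε / 4 with hη
    have hη0 : 0 < η := by positivity
    -- Radius `δ η / 2` puts points of one ball within `δ η` of each other; finitely many balls
    -- leave finitely many smallness conditions. The resulting error `3 * η` is below `ε`.
    obtain ⟨t, -, ht⟩ := (isCompact_univ (X := S)).elim_nhds_subcover
      (fun x => Metric.ball x (δ η / 2)) fun x _ => Metric.ball_mem_nhds x (half_pos (hδ η hη0))
    have h0 := tendsto_cylinderMeasure_hypograph_diff hc hβ hν hgm hgm₀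
    have hev : ∀ᶠ n in atTop, ∀ x ∈ t, β (Metric.ball x (δ η / 2)) ≠ 0 →
        cylinderMeasure β (hypograph (fun s => (g n s : ℝ)) \ hypograph fun s => (g₀ s : ℝ))
          < η * β (Metric.ball x (δ η / 2)) := by
      rw [Filter.eventually_all_finset]
      intro x _
      by_cases hx : β (Metric.ball x (δ η / 2)) = 0
      · exact Eventually.of_forall fun n h => absurd hx h
      · refine (h0.eventually_lt_const (ENNReal.mul_pos ?_ hx)).mono fun n h _ => h
        exact_mod_cast hη0.ne'
    filter_upwards [hev] with n hn s hs
    obtain ⟨x, hx, hsx⟩ := Set.mem_iUnion₂.1 (ht (Set.mem_univ s))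
    have hβx : β (Metric.ball x (δ η / 2)) ≠ 0 :=
      ((Measure.mem_support_iff_forall s).1 hs.2 _ (Metric.isOpen_ball.mem_nhds hsx)).ne'
    have hloc : ∀ {g : S → ℝ≥0} {D : Set S}, E ⊆ D →
        (∀ η, 0 < η → ∀ s ∈ D, ∀ s' ∈ D, dist s s' < δ η → g s ≤ g s' + η) →
        ∀ s ∈ E ∩ Metric.ball x (δ η / 2), ∀ s' ∈ E ∩ Metric.ball x (δ η / 2),
          g s ≤ g s' + η := by
      intro g D hED hmod s hs s' hs'
      refine hmod η hη0 s (hED hs.1) s' (hED hs'.1) ?_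
      calc dist s s' ≤ dist s x + dist s' x := dist_triangle_right _ _ _
        _ < δ η / 2 + δ η / 2 := add_lt_add hs.2 hs'.2
        _ = δ η := add_halves _
    have hlt := hn x hx hβx
    have h1 := le_add_of_cylinderMeasure_diff_lt hg₀ (hg n) hEae
      (hloc hE₀ hmod₀) (hloc (hEn n) (hmod n)) hlt ⟨hs, hsx⟩
    rw [cylinderMeasure_hypograph_diff_comm (hgm n).isDensity hgm₀.isDensity] at hlt
    have h2 := le_add_of_cylinderMeasure_diff_lt (hg n) hg₀ hEae
      (hloc (hEn n) (hmod n)) (hloc hE₀ hmod₀) hlt ⟨hs, hsx⟩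
    rw [← NNReal.coe_le_coe] at h1 h2
    have hηε : (η : ℝ) = ε / 4 := by simp [hη]
    push_cast at h1 h2
    rw [Real.dist_eq, abs_lt]
    constructor <;> linarith
  obtain ⟨v, v₀, hv, hv₀, hvlim⟩ := exists_tendstoUniformly_extension
    (fun n => huc (hEn n) (hmod n)) (huc hE₀ hmod₀) hlim
  refine ⟨v, v₀, fun n => ⟨(hv n).1, ?_⟩, ⟨hv₀.1, ?_⟩, hvlim⟩
  · filter_upwards [(hp n).ae_eq hc hβ (hgm n), hEae] with s hs hsE
    rw [hs, (hv n).2 s hsE]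
  · filter_upwards [hp₀.ae_eq hc hβ hgm₀, hEae] with s hs hsE
    rw [hs, hv₀.2 s hsE]

end

/-! ### The free surface problem -/

theorem CostAssumption.isHeightCost {E E' : Type*} [PseudoEMetricSpace E] [PseudoEMetricSpace E']
    {B : Set E} {Y : Set E'} {c : (B × ℝ≥0) × Y → ℝ≥0} (hc : CostAssumption c) : IsHeightCost c :=
  ⟨hc.locallyLipschitz.continuous, hc.strictMono, hc.unbounded⟩

/-! ### Almost everywhere classes and measurable densities -/

section

variable {S : Type*} [MeasurableSpace S] [TopologicalSpace S] {β : Measure S} [IsFiniteMeasure β]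

theorem isDensity_coe_Lp {r : ℝ≥0∞} (hr : 1 ≤ r) {p : Lp ℝ r β} (h0 : 0 ≤ p)
    (h1 : ∫ s, p s ∂β = 1) : IsDensity β p := by
  have hnn : 0 ≤ᵐ[β] p := (Lp.coeFn_nonneg p).2 h0
  refine ⟨(Lp.stronglyMeasurable p).measurable, hnn, ?_⟩
  rw [← ofReal_integral_eq_lintegral_ofReal ((Lp.memLp p).integrable hr) hnn, h1,
    ENNReal.ofReal_one]

theorem IsDensity.exists_Lp {q : S → ℝ} (hq : IsDensity β q) :
    ∃ p : Lp ℝ 1 β, (0 ≤ p ∧ ∫ s, p s ∂β = 1) ∧ p =ᵐ[β] q := by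
  have hint : Integrable q β := by
    refine ⟨hq.measurable.aestronglyMeasurable, ?_⟩
    rw [hasFiniteIntegral_iff_ofReal hq.nonneg, hq.lintegral_eq_one]
    exact ENNReal.one_lt_top
  have hmem : MemLp q 1 β := memLp_one_iff_integrable.2 hint
  refine ⟨hmem.toLp q, ⟨?_, ?_⟩, hmem.coeFn_toLp⟩
  · refine (Lp.coeFn_nonneg _).1 ?_
    filter_upwards [hmem.coeFn_toLp, hq.nonneg] with s h1 h2
    rw [h1]; exact h2
  · rw [integral_congr_ae hmem.coeFn_toLp, integral_eq_lintegral_of_nonneg_ae hq.nonneg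
      hq.measurable.aestronglyMeasurable, hq.lintegral_eq_one, ENNReal.toReal_one]

theorem ae_abs_sub_le_norm (p q : Lp ℝ ∞ β) : ∀ᵐ s ∂β, |p s - q s| ≤ ‖p - q‖ := by
  have h := ae_le_eLpNormEssSup (f := (p - q : Lp ℝ ∞ β)) (μ := β)
  filter_upwards [h, Lp.coeFn_sub p q] with s hs hsub
  rw [← Real.norm_eq_abs, ← Pi.sub_apply, ← hsub, Lp.norm_def, eLpNorm_exponent_top,
    ← toReal_enorm]
  refine ENNReal.toReal_mono ?_ hs
  rw [← eLpNorm_exponent_top]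
  exact Lp.eLpNorm_ne_top _

end

section

variable {E E' : Type*} [MetricSpace E] [MeasureSpace E] [BorelSpace E] [MetricSpace E']
  [MeasurableSpace E'] [BorelSpace E'] {B : Set E} {Y : Set E'} [CompactSpace B] [CompactSpace Y]
  [IsFiniteMeasure (lebesgueB B)] {c : (B × ℝ≥0) × Y → ℝ≥0}

theorem Pac.isDensity (p : Pac B) : IsDensity (lebesgueB B) p.1 :=
  isDensity_coe_Lp le_rfl p.2.1 p.2.2

theorem PacBdd.isDensity (p : PacBdd B) : IsDensity (lebesgueB B) p.1 :=
  isDensity_coe_Lp le_top p.2.1 p.2.2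

theorem PacBdd.exists_ae_le (p : PacBdd B) : ∃ R : ℝ≥0, ∀ᵐ s ∂lebesgueB B, p.1 s ≤ R := by
  refine ⟨‖p.1‖₊, ?_⟩
  filter_upwards [ae_abs_sub_le_norm p.1 0, Lp.coeFn_zero ℝ ∞ (lebesgueB B)] with s hs h0
  rw [h0, sub_zero] at hs
  simpa using (le_abs_self _).trans hs

theorem primal_eq (ν : ProbabilityMeasure Y) (p : B → ℝ) :
    primal c ν p = transportCost c (hypographMeasure (lebesgueB B) p) (ν : Measure Y) := rfl

/-- Each measurable density has an `L¹` class with the same hypograph measure. -/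
theorem isMinimiser_iff (ν : ProbabilityMeasure Y) (p : Pac B) :
    IsMinimiser c ν p ↔ IsMinimalDensity c (lebesgueB B) (ν : Measure Y) p.1 := by
  constructor
  · refine fun h => ⟨Pac.isDensity p, fun q hq => ?_⟩
    obtain ⟨q', hq', hqq⟩ := hq.exists_Lp
    have := h ⟨q', hq'⟩
    rwa [primal_eq, primal_eq, hypographMeasure_congr _ hqq] at this
  · exact fun h q => h.le _ (Pac.isDensity q)

theorem tendsto_primal (hc : Continuous c) {ι : Type*} {l : Filter ι} {p : ι → PacBdd B}
    {p₀ : PacBdd B} (hp : Tendsto p l (𝓝 p₀)) {ν : ι → ProbabilityMeasure Y}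
    {ν₀ : ProbabilityMeasure Y} (hν : Tendsto ν l (𝓝 ν₀)) :
    Tendsto (fun i => primal c (ν i) (p i).1) l (𝓝 (primal c ν₀ p₀.1)) := by
  obtain ⟨R, hR⟩ := PacBdd.exists_ae_le p₀
  refine tendsto_transportCost_hypograph _ hc (fun i => (PacBdd.isDensity (p i)).measurable)
    (PacBdd.isDensity p₀).measurable (fun i => (PacBdd.isDensity (p i)).lintegral_eq_one)
    (PacBdd.isDensity p₀).lintegral_eq_one hR (fun η hη => ?_) hν
  have hp' : Tendsto (fun i => (p i).1) l (𝓝 p₀.1) := (continuous_subtype_val.tendsto _).comp hp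
  have hev := Metric.tendsto_nhds.1 hp' η (by exact_mod_cast hη)
  filter_upwards [hev] with i hi
  filter_upwards [ae_abs_sub_le_norm (p i).1 p₀.1] with s hs
  rw [dist_eq_norm] at hi
  exact hs.trans hi.le

theorem primal_ne_top (hc : Continuous c) (p : PacBdd B) (ν : ProbabilityMeasure Y) :
    primal c ν p.1 ≠ ∞ := by
  obtain ⟨R, hR⟩ := PacBdd.exists_ae_le p
  exact transportCost_ne_top _ hc (PacBdd.isDensity p).measurable
    (PacBdd.isDensity p).lintegral_eq_one hR ν

theorem continuous_primal (hc : Continuous c) :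
    Continuous fun x : PacBdd B × ProbabilityMeasure Y => (primal c x.2 x.1.1).toReal := by
  refine continuous_iff_continuousAt.2 fun x => ?_
  exact (ENNReal.tendsto_toReal (primal_ne_top hc x.1 x.2)).comp
    (tendsto_primal hc (continuous_fst.tendsto x) (continuous_snd.tendsto x))

theorem existsUnique_isMinimiser (hc : IsHeightCost c) (hB : lebesgueB B ≠ 0)
    (ν : ProbabilityMeasure Y) : ∃! p : Pac B, IsMinimiser c ν p := by
  obtain ⟨q, hq⟩ := hc.exists_isMinimalDensity hB ν
  obtain ⟨p, hp, hpq⟩ := hq.isDensity.exists_Lp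
  refine ⟨⟨p, hp⟩, fun r => ?_, fun r hr => ?_⟩
  · rw [primal_eq, primal_eq, hypographMeasure_congr _ hpq]
    exact hq.le _ (Pac.isDensity r)
  · exact Subtype.ext (Lp.ext ((((isMinimiser_iff ν r).1 hr).ae_eq hc hB hq).trans hpq.symm))

/-- Values converge along every convergent sequence of densities, so constant sequences are recovery
sequences. -/
theorem gammaConverges_primal (hc : Continuous c) {νn : ℕ → ProbabilityMeasure Y}
    {ν : ProbabilityMeasure Y} (hν : Tendsto νn atTop (𝓝 ν)) :
    GammaConverges (fun n (p : PacBdd B) => primal c (νn n) p.1)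
      (fun p : PacBdd B => primal c ν p.1) := fun p =>
  ⟨fun _ hu => (tendsto_primal hc hu hν).liminf_eq.ge,
    fun _ => p, tendsto_const_nhds, (tendsto_primal hc tendsto_const_nhds hν).limsup_eq.le⟩

end

end

theorem theorem4p1 (d : ℕ) (hd : 2 ≤ d)
    (B : Set (EuclideanSpace ℝ (Fin (d - 1)))) (hB : IsCompact B) (hBint : (interior B).Nonempty)
    (Y : Set (EuclideanSpace ℝ (Fin d))) (hY : IsCompact Y) (hYne : Y.Nonempty)
    (c : (B × ℝ≥0) × Y → ℝ≥0) (hc : CostAssumption c) :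
    -- `F` is real-valued and jointly continuous on bounded densities
    (∀ (p : PacBdd B) (ν : ProbabilityMeasure Y), primal c ν p.1 ≠ ∞) ∧
    Continuous (fun x : PacBdd B × ProbabilityMeasure Y => (primal c x.2 x.1.1).toReal) ∧
    -- minimisers over all absolutely continuous probability measures exist and are unique
    (∀ ν : ProbabilityMeasure Y, ∃! p : Pac B, IsMinimiser c ν p) ∧
    -- stability
    ∀ (νn : ℕ → ProbabilityMeasure Y) (ν : ProbabilityMeasure Y), Tendsto νn atTop (𝓝 ν) →
      GammaConverges (fun n (p : PacBdd B) => primal c (νn n) p.1)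
        (fun p : PacBdd B => primal c ν p.1) ∧
      ∀ (pn : ℕ → Pac B) (p : Pac B), (∀ n, IsMinimiser c (νn n) (pn n)) → IsMinimiser c ν p →
        (∃ (fn : ℕ → B → ℝ) (f : B → ℝ),
          (∀ n, Continuous (fn n) ∧ (pn n).1 =ᵐ[lebesgueB B] fn n) ∧
          (Continuous f ∧ p.1 =ᵐ[lebesgueB B] f) ∧
          TendstoUniformly fn f atTop) ∧
        Tendsto (fun n => eLpNorm (sourceDensity (pn n).1 - sourceDensity p.1) 1 (lebesgueX B))
          atTop (𝓝 0) ∧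
        ∀ γn : ℕ → ProbabilityMeasure ((B × ℝ≥0) × Y),
          (∀ n, IsOptimalPlan c (sourceMeasure (pn n).1) (νn n : Measure Y) (γn n)) →
          ∃ (φ : ℕ → ℕ) (γ : ProbabilityMeasure ((B × ℝ≥0) × Y)),
            StrictMono φ ∧ IsOptimalPlan c (sourceMeasure p.1) (ν : Measure Y) γ ∧
            Tendsto (fun k => γn (φ k)) atTop (𝓝 γ) := by
  have hcc := hc.isHeightCost
  have : CompactSpace B := isCompact_iff_compactSpace.1 hB
  have : CompactSpace Y := isCompact_iff_compactSpace.1 hY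
  have huniv : lebesgueB B Set.univ = volume B := by
    rw [lebesgueB, comap_subtype_coe_apply hB.measurableSet, Set.image_univ,
      Subtype.range_coe]
  have : IsFiniteMeasure (lebesgueB B) := ⟨by rw [huniv]; exact hB.measure_lt_top⟩
  have hB0 : lebesgueB B ≠ 0 := by
    rw [← Measure.measure_univ_ne_zero, huniv]
    exact (Measure.measure_pos_of_nonempty_interior _ hBint).ne'
  refine ⟨primal_ne_top hcc.continuous, continuous_primal hcc.continuous,
    existsUnique_isMinimiser hcc hB0,
    fun νn ν hν => ⟨gammaConverges_primal hcc.continuous hν, fun pn p hpn hp => ?_⟩⟩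
  have hpn' := fun n => (isMinimiser_iff (νn n) (pn n)).1 (hpn n)
  have hp' := (isMinimiser_iff ν p).1 hp
  refine ⟨exists_continuous_representatives hcc hB0 hν hpn' hp',
    tendsto_eLpNorm_indicator_hypograph hcc hB0 hν hpn' hp', fun γn hγn => ?_⟩
  -- Optimal plans of minimisers are optimal relaxed plans, which are compact; the first marginal of
  -- the limit is then forced by uniqueness.
  obtain ⟨φ, γ, hφ, hγ, hlim⟩ := exists_subseq_tendsto_isRelaxedOptimal hcc hB0 hν
    fun n => (hpn' n).isRelaxedOptimal hcc hB0 (hγn n)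
  have hfst := hp'.map_fst_eq hcc hB0 hγ
  exact ⟨φ, γ, hφ, ⟨⟨hfst, hγ.mem.2⟩, (hγ.transportCost_eq hfst).symm⟩, hlim⟩
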